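/- All systems are finite-dimensional, $\log=\log_2$, and a quantum channel is a completely positive trace-preserving map, given by Kraus operators. **The routing task.** Let $n\ge 0$, $d\ge 1$ and $f:\{0,1\}^{2n}\to\{0,1\}$. In the $f$-routing task, a $d$-dimensional system $Q$, maximally entangled with a reference system $\bar Q$, and a string $x\in\{0,1\}^n$ are given on the left, and a string $y\in\{0,1\}^n$ is given on the right; $x,y$ are uniformly random. A $d$-dimensional system $B_0$ is returned on the left and a $d$-dimensional system $B_1$ on the right. The task is completed if a test of whether $\bar Q B_{f(x,y)}$ is in the maximally entangled state succeeds with probability $1$. A *non-local protocol* using a maximally entangled resource of local dimension $D\ge 1$ works as follows. The left and right sides share a maximally entangled state of two $D$-dimensional systems $L,R$. The left side applies a channel depending on $x$ to $QL$, with output a system that is kept and a system that is sent to the right; the right side applies a channel depending on $y$ to $R$, with output a system that is kept and a system that is sent to the left. In this single simultaneous round of communication $x$ and $y$ are exchanged as well. Finally each side applies a channel depending on $(x,y)$ to the system it kept together with the system it received, and outputs $B_0$ (left) or $B_1$ (right). Such a protocol uses entanglement $\log D$ (that is, $\log D$ EPR pairs), and the *entanglement cost* $E(f)$ is the infimum of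 $\log D$ over all non-local protocols that complete the $f$-routing task. **Secret sharing.** A quantum secret sharing scheme with $2n$ shares for a $d$-dimensional secret is a channel from the secret $Q$ to $S_1\otimes\dots\otimes S_{2n}$ with $\dim S_i=d_i$. A set of shares is *authorized* if some channel acting on these shares alone recovers every state of $Q$, and *unauthorized* if the reduced state of these shares is the same for all states of $Q$. The scheme has *indicator function* $f$ if, for every $z\in\{0,1\}^{2n}$, the set $\{S_i: z_i=1\}$ is authorized when $f(z)=1$ and unauthorized when $f(z)=0$. The *size* of the scheme is $\sum_{i=1}^{2n}\log d_i$. A function $f$ is a *valid indicator function* if it is monotone and no-cloning, i.e. $f(z)=1$ implies $f(\bar z)=0$, where $\bar z$ is the bitwise complement of $z$. **Theorem.** Let $f:\{0,1\}^{2n}\to\{0,1\}$ be a valid indicator function, and consider any quantum secret sharing scheme for a $d$-dimensional secret with $2n$ shares whose indicator function is $f(z)$, $z=(x,y)$. Then the $f$-routing task on a $d$-dimensional system is completed by a non-local protocol whose resource is a maximally entangled state of local dimension $D=\prod_{i=1}^{2n}d_i$, so that $\log D$ equals the size of the scheme. In particular, $$E(f)\;\le\;\sum_{i=1}^{2n}\log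 d_i .$$ -/

import Mathlib

open scoped Kronecker ComplexOrder

noncomputable section

namespace QRouting

/-! ### Finite-dimensional quantum channels -/

/-- A quantum channel from the system with orthonormal basis `a` to the system with
orthonormal basis `b`, given by finitely many Kraus operators `K k` satisfying the
trace-preservation condition `∑ k, (K k)ᴴ * K k = 1`. -/
structure Channel (a b : Type) [Fintype a] [DecidableEq a] [Fintype b] where
  /-- labels of the Kraus operators -/
  κ : Type
  [fintypeκ : Fintype κ]
  /-- the Kraus operators -/
  kraus : κ → Matrix b a ℂ
  tracePreserving : ∑ k, (kraus k).conjTranspose * kraus k = 1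

attribute [instance] Channel.fintypeκ

namespace Channel

/-- The action of a channel on (density) matrices, `ρ ↦ ∑ k, K k * ρ * (K k)ᴴ`. -/
def apply {a b : Type} [Fintype a] [DecidableEq a] [Fintype b] (Φ : Channel a b)
    (ρ : Matrix a a ℂ) : Matrix b b ℂ :=
  ∑ k, Φ.kraus k * ρ * (Φ.kraus k).conjTranspose

/-- The identity channel. -/
def id (a : Type) [Fintype a] [DecidableEq a] : Channel a a where
  κ := Unit
  kraus := fun _ => 1
  tracePreserving := by simp

/-- The tensor product of two channels. -/
def tensor {a b c e : Type} [Fintype a] [DecidableEq a] [Fintype b]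
    [Fintype c] [DecidableEq c] [Fintype e] (Φ : Channel a b) (Ψ : Channel c e) :
    Channel (a × c) (b × e) where
  κ := Φ.κ × Ψ.κ
  kraus := fun k => Φ.kraus k.1 ⊗ₖ Ψ.kraus k.2
  tracePreserving := by
    have h : ∀ k : Φ.κ × Ψ.κ,
        (Φ.kraus k.1 ⊗ₖ Ψ.kraus k.2).conjTranspose * (Φ.kraus k.1 ⊗ₖ Ψ.kraus k.2)
          = ((Φ.kraus k.1).conjTranspose * Φ.kraus k.1) ⊗ₖ
            ((Ψ.kraus k.2).conjTranspose * Ψ.kraus k.2) := by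
      intro k
      rw [Matrix.conjTranspose_kronecker, Matrix.mul_kronecker_mul]
    simp only [h]
    rw [← Matrix.one_kronecker_one, ← Φ.tracePreserving, ← Ψ.tracePreserving]
    ext i j
    simp only [Matrix.sum_apply, Matrix.kroneckerMap_apply, Fintype.sum_prod_type,
      Finset.sum_mul_sum]

end Channel

/-- `ρ` is a density matrix: positive semidefinite of trace one. -/
def IsState {a : Type} [Fintype a] (ρ : Matrix a a ℂ) : Prop :=
  ρ.PosSemidef ∧ ρ.trace = 1

/-- The partial trace over the second tensor factor. -/
def traceRight {a b : Type} [Fintype b] (ρ : Matrix (a × b) (a × b) ℂ) : Matrix a a ℂ :=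
  Matrix.of fun i j => ∑ k, ρ (i, k) (j, k)

/-- The partial trace over the first tensor factor. -/
def traceLeft {a b : Type} [Fintype a] (ρ : Matrix (a × b) (a × b) ℂ) : Matrix b b ℂ :=
  Matrix.of fun i j => ∑ k, ρ (k, i) (k, j)

/-- The density matrix of the maximally entangled state
`|a|^(-1/2) ∑ i, |i⟩ ⊗ |i⟩` of two copies of the system with basis `a`. -/
def maxEntangled (a : Type) [Fintype a] [DecidableEq a] : Matrix (a × a) (a × a) ℂ :=
  Matrix.of fun p q => if p.1 = p.2 ∧ q.1 = q.2 then ((Fintype.card a : ℂ))⁻¹ else 0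

/-! ### Quantum secret sharing -/

/-- A valid indicator function: monotone, and no-cloning, i.e. `f z = 1` implies that `f`
vanishes on the bitwise complement of `z`. -/
def IsValidIndicator {ι : Type} (f : (ι → Bool) → Bool) : Prop :=
  Monotone f ∧ ∀ z, f z = true → f (fun i => !(z i)) = false

/-- An encoding of a `d`-dimensional secret into shares `S i` of dimension `dim i`. -/
structure SharingScheme (ι : Type) [Fintype ι] [DecidableEq ι] (d : ℕ) where
  /-- the dimensions of the shares -/
  dim : ι → ℕ
  /-- the encoding map, from the secret to the tensor product of all shares -/
  encode : Channel (Fin d) ((i : ι) → Fin (dim i))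

namespace SharingScheme

variable {ι : Type} [Fintype ι] [DecidableEq ι] {d : ℕ}

/-- The basis of the joint system of the shares `S i` with `z i = 1`. -/
abbrev Shares (S : SharingScheme ι d) (z : ι → Bool) : Type :=
  (i : {i // z i = true}) → Fin (S.dim i)

/-- The state, on the shares `S i` with `z i = 1`, of the encoding of `ρ`: all other shares
are traced out. -/
def reduced (S : SharingScheme ι d) (z : ι → Bool) (ρ : Matrix (Fin d) (Fin d) ℂ) :
    Matrix (S.Shares z) (S.Shares z) ℂ :=
  let e := Equiv.piEquivPiSubtypeProd (fun i => z i = true) (fun i => Fin (S.dim i))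
  traceRight ((S.encode.apply ρ).submatrix e.symm e.symm)

/-- The shares `S i` with `z i = 1` form an authorized set: some channel acting on them
alone recovers the secret. -/
def Authorized (S : SharingScheme ι d) (z : ι → Bool) : Prop :=
  ∃ R : Channel (S.Shares z) (Fin d),
    ∀ ρ : Matrix (Fin d) (Fin d) ℂ, IsState ρ → R.apply (S.reduced z ρ) = ρ

/-- The shares `S i` with `z i = 1` form an unauthorized set: their joint state does not
depend on the secret. -/
def Unauthorized (S : SharingScheme ι d) (z : ι → Bool) : Prop :=
  ∃ σ : Matrix (S.Shares z) (S.Shares z) ℂ,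
    ∀ ρ : Matrix (Fin d) (Fin d) ℂ, IsState ρ → S.reduced z ρ = σ

/-- `S` is a quantum secret sharing scheme with indicator function `f`. -/
def HasIndicator (S : SharingScheme ι d) (f : (ι → Bool) → Bool) : Prop :=
  ∀ z, (f z = true → S.Authorized z) ∧ (f z = false → S.Unauthorized z)

/-- The size of the scheme, the sum of the `log₂`-dimensions of the shares. -/
def size (S : SharingScheme ι d) : ℝ :=
  ∑ i, Real.logb 2 (S.dim i)

end SharingScheme

/-! ### Non-local protocols for the routing task -/

/-- A non-local protocol for routing a `d`-dimensional system `Q`, with an `n`-bit string `x`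
given on the left together with `Q` and an `n`-bit string `y` given on the right. The two
sides share a maximally entangled state of two copies of the system `L`. Each side acts
once on its input and its half of the resource, there is one simultaneous round of
communication (in which the classical inputs are exchanged as well), and each side acts
once more and returns a `d`-dimensional system. -/
structure RoutingProtocol (n d : ℕ) where
  /-- each half of the shared maximally entangled resource -/
  L : Type
  [fintypeL : Fintype L]
  [decEqL : DecidableEq L]
  [nonemptyL : Nonempty L]
  /-- system kept on the left -/
  K₀ : Type
  [fintypeK₀ : Fintype K₀]
  [decEqK₀ : DecidableEq K₀]
  /-- system sent from left to right -/
  M₀ : Type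
  [fintypeM₀ : Fintype M₀]
  [decEqM₀ : DecidableEq M₀]
  /-- system sent from right to left -/
  M₁ : Type
  [fintypeM₁ : Fintype M₁]
  [decEqM₁ : DecidableEq M₁]
  /-- system kept on the right -/
  K₁ : Type
  [fintypeK₁ : Fintype K₁]
  [decEqK₁ : DecidableEq K₁]
  /-- first operation on the left, acting on `Q` and the left half of the resource -/
  first₀ : (x : Fin n → Bool) → Channel (Fin d × L) (K₀ × M₀)
  /-- first operation on the right, acting on the right half of the resource -/
  first₁ : (y : Fin n → Bool) → Channel L (M₁ × K₁)
  /-- second operation on the left, after the communication -/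
  second₀ : (x y : Fin n → Bool) → Channel (K₀ × M₁) (Fin d)
  /-- second operation on the right, after the communication -/
  second₁ : (x y : Fin n → Bool) → Channel (M₀ × K₁) (Fin d)

attribute [instance] RoutingProtocol.fintypeL RoutingProtocol.decEqL RoutingProtocol.nonemptyL
  RoutingProtocol.fintypeK₀ RoutingProtocol.decEqK₀ RoutingProtocol.fintypeM₀
  RoutingProtocol.decEqM₀ RoutingProtocol.fintypeM₁ RoutingProtocol.decEqM₁
  RoutingProtocol.fintypeK₁ RoutingProtocol.decEqK₁

namespace RoutingProtocol

variable {n d : ℕ}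

/-- Regroup (reference, `Q`) and (left half, right half) of the resource into the reference,
the systems on the left, and the system on the right. -/
def inputEquiv (q l : Type) : q × ((q × l) × l) ≃ (q × q) × (l × l) where
  toFun p := ((p.1, p.2.1.1), (p.2.1.2, p.2.2))
  invFun p := (p.1.1, ((p.1.2, p.2.1), p.2.2))
  left_inv _ := rfl
  right_inv _ := rfl

/-- The communication round: the two middle systems are exchanged. -/
def exchangeEquiv (q k₀ m₀ m₁ k₁ : Type) :
    q × ((k₀ × m₁) × (m₀ × k₁)) ≃ q × ((k₀ × m₀) × (m₁ × k₁)) where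
  toFun p := (p.1, ((p.2.1.1, p.2.2.1), (p.2.1.2, p.2.2.2)))
  invFun p := (p.1, ((p.2.1.1, p.2.2.1), (p.2.1.2, p.2.2.2)))
  left_inv _ := rfl
  right_inv _ := rfl

/-- The initial state: `Q` is maximally entangled with a reference system, and the two halves
of the resource are maximally entangled. -/
def initialState (P : RoutingProtocol n d) :
    Matrix (Fin d × ((Fin d × P.L) × P.L)) (Fin d × ((Fin d × P.L) × P.L)) ℂ :=
  (maxEntangled (Fin d) ⊗ₖ maxEntangled P.L).submatrix
    (inputEquiv (Fin d) P.L) (inputEquiv (Fin d) P.L)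

/-- The final joint state of the reference system, the left output and the right output, on
inputs `x` and `y`. -/
def finalState (P : RoutingProtocol n d) (x y : Fin n → Bool) :
    Matrix (Fin d × (Fin d × Fin d)) (Fin d × (Fin d × Fin d)) ℂ :=
  let ρ := ((Channel.id (Fin d)).tensor ((P.first₀ x).tensor (P.first₁ y))).apply P.initialState
  let e := exchangeEquiv (Fin d) P.K₀ P.M₀ P.M₁ P.K₁
  ((Channel.id (Fin d)).tensor ((P.second₀ x y).tensor (P.second₁ x y))).apply
    (ρ.submatrix e e)

/-- The state of the reference system and the output on side `b` (`false` is the left, where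
`x` and `Q` are given, and `true` is the right, where `y` is given). -/
def outputState (P : RoutingProtocol n d) (x y : Fin n → Bool) (b : Bool) :
    Matrix (Fin d × Fin d) (Fin d × Fin d) ℂ :=
  match b with
  | false =>
      traceRight ((P.finalState x y).submatrix
        (Equiv.prodAssoc (Fin d) (Fin d) (Fin d)) (Equiv.prodAssoc (Fin d) (Fin d) (Fin d)))
  | true =>
      traceLeft ((P.finalState x y).submatrix
        (fun p : Fin d × (Fin d × Fin d) => (p.2.1, (p.1, p.2.2)))
        (fun p : Fin d × (Fin d × Fin d) => (p.2.1, (p.1, p.2.2))))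

/-- The probability that the reference system and the output on side `f (x, y)` pass the test
for being in the maximally entangled state, for uniformly random `x` and `y`. -/
def successProb (P : RoutingProtocol n d) (f : (Fin n ⊕ Fin n → Bool) → Bool) : ℝ :=
  (∑ x : Fin n → Bool, ∑ y : Fin n → Bool,
    (maxEntangled (Fin d) * P.outputState x y (f (Sum.elim x y))).trace.re) /
      ((2 : ℝ) ^ n * (2 : ℝ) ^ n)

/-- The protocol completes the `f`-routing task: the test succeeds with certainty. -/
def Completes (P : RoutingProtocol n d) (f : (Fin n ⊕ Fin n → Bool) → Bool) : Prop :=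
  P.successProb f = 1

/-- The entanglement used: a maximally entangled state of two `D`-dimensional systems
counts as `log₂ D` EPR pairs. -/
def entanglement (P : RoutingProtocol n d) : ℝ :=
  Real.logb 2 (Fintype.card P.L)

end RoutingProtocol

/-- The entanglement cost of the `f`-routing task on a `d`-dimensional system: the least
entanglement used by a non-local protocol completing it (`⊤` if there is none). -/
def entanglementCost (n d : ℕ) (f : (Fin n ⊕ Fin n → Bool) → Bool) : EReal :=
  ⨅ (P : RoutingProtocol n d) (_ : P.Completes f), ((P.entanglement : ℝ) : EReal)

end QRouting

end

open scoped Kronecker ComplexOrder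

noncomputable section

namespace QRouting

open Matrix

/-! The left side applies a Stinespring isometry of the encoding to `Q`, which yields the first `n`
shares `A`, the last `n` shares `B` and the environment `κ`. It Bell-measures `B` against the
`B`-half of the resource, so the right side holds `B` up to a shift `j` and a phase `χ`; no
correction is applied. In the single round, the left sends the shares with `x i = 1`, the right
sends those with `y i = 0`, and the Bell outcome is copied to both sides. The right then holds
exactly the shares with `z i = 1`, and the left holds all others together with the environment. If
`f z = 1`, the secret is recoverable on the right by authorization. If `f z = 0`, the right's state
is independent of the secret, and since the global encoding is pure, the complement, environment
included, recovers it.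

Recovery is treated through the Knill–Laflamme condition: operators `V a` can be undone by a channel
as soon as every `(V a)ᴴ * V b` is a scalar (`exists_recovery`), and conversely
(`exists_smul_one_of_recovers`). Authorization gives the scalars through the converse. Unauthorized
sets give them directly, because constancy of the reduced state is the Knill–Laflamme condition for
the complement.

Basis labels form the group `∏ i, Fin (S.dim i)`, where the shift acts share by share and so splits
between the two sides. Thus the scalars survive uncorrected teleportation
(`teleportProtocol_rightOp`, `teleportProtocol_leftOp`), and the final operations come from
`exists_recovery`. The `A`-half of the resource is only measured in its basis; it makes the local
dimension the full product. -/

/-! ### Sufficiency of the Knill–Laflamme condition -/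

/-- **Knill–Laflamme recovery**, for error operators with mutually orthogonal ranges. -/
theorem exists_recovery_of_orthogonal {E Q α : Type} [Fintype E] [DecidableEq E] [Fintype Q]
    [DecidableEq Q] [Nonempty Q] [Fintype α] [DecidableEq α] (W : α → Matrix E Q ℂ) (w : α → ℝ)
    (hw : ∀ a, 0 ≤ w a)
    (h : ∀ a b, (W a)ᴴ * W b = (if a = b then (w a : ℂ) else 0) • (1 : Matrix Q Q ℂ)) :
    ∃ R : Channel E Q, ∀ a X, R.apply (W a * X * (W a)ᴴ) = (w a : ℂ) • X := by
  obtain ⟨q₀⟩ := ‹Nonempty Q›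
  -- The projection onto the sum of the ranges. With `0⁻¹ = 0`, operators of weight zero, which
  -- vanish, drop out.
  set P : Matrix E E ℂ := ∑ a, ((w a : ℂ)⁻¹) • (W a * (W a)ᴴ) with hP
  have hPW : ∀ a, P * W a = W a := by
    intro a
    have h1 : P * W a = ((w a : ℂ)⁻¹ * (w a : ℂ)) • W a := by
      rw [hP, Matrix.sum_mul, Finset.sum_eq_single a]
      · rw [Matrix.smul_mul, Matrix.mul_assoc, h, if_pos rfl, Matrix.mul_smul, Matrix.mul_one,
          smul_smul]
      · intro b _ hb
        rw [Matrix.smul_mul, Matrix.mul_assoc, h, if_neg hb, zero_smul, Matrix.mul_zero, smul_zero]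
      · simp
    rw [h1]
    by_cases h0 : w a = 0
    · have : W a = 0 := by
        rw [← Matrix.conjTranspose_mul_self_eq_zero, h]
        simp [h0]
      simp [this]
    · rw [inv_mul_cancel₀ (by exact_mod_cast h0), one_smul]
  have hPP : P * P = P := by
    nth_rewrite 2 [hP]
    rw [Matrix.mul_sum]
    simp only [Matrix.mul_smul, ← Matrix.mul_assoc, hPW]
    rfl
  have hPh : Pᴴ = P := by
    simp [hP, Matrix.conjTranspose_sum, Matrix.conjTranspose_smul, Matrix.conjTranspose_mul]
  -- Outside the range of `P` the system is reset to `q₀`; this completes the Kraus family to a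
  -- trace-preserving one.
  let S : E → Matrix Q E ℂ := fun e => Matrix.single q₀ e (1 : ℂ)
  have hSS : ∀ e, (S e)ᴴ * S e = Matrix.single e e (1 : ℂ) := by
    intro e
    simp [S]
  have hsq : ∀ a, ((Real.sqrt (w a) : ℂ)⁻¹) * ((Real.sqrt (w a) : ℂ)⁻¹) = (w a : ℂ)⁻¹ := by
    intro a
    rw [← mul_inv, ← Complex.ofReal_mul, Real.mul_self_sqrt (hw a)]
  refine ⟨{ κ := α ⊕ E
            kraus := Sum.elim (fun a => ((Real.sqrt (w a) : ℂ)⁻¹) • (W a)ᴴ)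
              (fun e => S e * (1 - P))
            tracePreserving := ?_ }, ?_⟩
  · rw [Fintype.sum_sum_type]
    simp only [Sum.elim_inl, Sum.elim_inr, conjTranspose_smul, conjTranspose_conjTranspose,
      Matrix.smul_mul, Matrix.mul_smul, smul_smul, conjTranspose_mul]
    have h1 : ∀ a, star ((Real.sqrt (w a) : ℂ)⁻¹) = ((Real.sqrt (w a) : ℂ)⁻¹) := by
      intro a; simp
    simp only [h1, hsq]
    rw [← hP]
    have h2 : ∀ e : E, (1 - P)ᴴ * (S e)ᴴ * (S e * (1 - P))
        = (1 - P) * Matrix.single e e 1 * (1 - P) := by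
      intro e
      rw [← hSS, conjTranspose_sub, hPh, conjTranspose_one]
      simp only [Matrix.mul_assoc]
    have h3 : ∑ e : E, Matrix.single e e (1 : ℂ) = 1 := by
      ext i j
      simp [Matrix.sum_apply, Matrix.single_apply, Matrix.one_apply, ite_and]
    simp only [h2]
    rw [← Finset.sum_mul, ← Finset.mul_sum, h3]
    simp only [mul_one, mul_sub, sub_mul, one_mul, hPP]
    abel
  · intro a X
    simp only [Channel.apply]
    rw [Fintype.sum_sum_type]
    simp only [Sum.elim_inl, Sum.elim_inr]
    have h2 : ∀ e : E, S e * (1 - P) * (W a * X * (W a)ᴴ) = 0 := by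
      intro e
      have : (1 - P) * W a = 0 := by rw [Matrix.sub_mul, hPW, Matrix.one_mul, sub_self]
      rw [Matrix.mul_assoc, ← Matrix.mul_assoc (1 - P), ← Matrix.mul_assoc (1 - P), this]
      simp
    simp only [h2, Matrix.zero_mul, Finset.sum_const_zero, add_zero]
    have h4 : ∀ b, ((Real.sqrt (w b) : ℂ)⁻¹) • (W b)ᴴ * (W a * X * (W a)ᴴ) *
        (((Real.sqrt (w b) : ℂ)⁻¹) • (W b)ᴴ)ᴴ =
        ((w b : ℂ)⁻¹) • (((W b)ᴴ * W a) * X * ((W a)ᴴ * W b)) := by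
      intro b
      rw [conjTranspose_smul, conjTranspose_conjTranspose, ← hsq b]
      simp [Matrix.smul_mul, Matrix.mul_smul, smul_smul, Matrix.mul_assoc]
    simp only [h4, h]
    rw [Finset.sum_eq_single a]
    · simp only [if_true, Matrix.smul_mul, Matrix.mul_smul, Matrix.one_mul, Matrix.mul_one,
        smul_smul]
      congr 1
      by_cases h0 : (w a : ℂ) = 0
      · simp [h0]
      · field_simp
    · intro b _ hb
      simp [hb]
    · simp

/-- **Knill–Laflamme recovery**: error operators `V a` with `(V a)ᴴ * V b` a multiple of the
identity for all `a`, `b` can be undone by a channel. -/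
theorem exists_recovery {E Q α : Type} [Fintype E] [DecidableEq E] [Fintype Q]
    [DecidableEq Q] [Nonempty Q] [Fintype α] (V : α → Matrix E Q ℂ)
    (h : ∀ a b, ∃ s : ℂ, (V a)ᴴ * V b = s • (1 : Matrix Q Q ℂ))
    (c : ℂ) (hc : ∑ a, (V a)ᴴ * V a = c • (1 : Matrix Q Q ℂ)) :
    ∃ R : Channel E Q, ∀ X, R.apply (∑ a, V a * X * (V a)ᴴ) = c • X := by
  classical
  have q₀ : Q := Classical.arbitrary Q
  choose s hs using h
  have hone : ∀ {u v : ℂ}, u • (1 : Matrix Q Q ℂ) = v • 1 → u = v := by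
    intro u v huv
    simpa using congrFun (congrFun huv q₀) q₀
  -- The scalars form a Gram matrix. Mixing the errors by a unitary that diagonalizes it makes their
  -- ranges orthogonal without changing the map they define.
  let σ : Matrix α α ℂ := Matrix.of s
  have hσ : σ.IsHermitian := by
    ext a b
    apply hone
    change star (s b a) • (1 : Matrix Q Q ℂ) = s a b • 1
    rw [← hs, ← conjTranspose_one (n := Q) (α := ℂ), ← conjTranspose_smul, ← hs]
    simp
  obtain ⟨U, hU2, hdiag⟩ : ∃ U : Matrix α α ℂ, U * Uᴴ = 1 ∧
      Uᴴ * σ * U = Matrix.diagonal (fun a => (hσ.eigenvalues a : ℂ)) := by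
    refine ⟨hσ.eigenvectorUnitary, Unitary.coe_mul_star_self hσ.eigenvectorUnitary, ?_⟩
    have := hσ.conjStarAlgAut_star_eigenvectorUnitary
    rw [Unitary.conjStarAlgAut_apply] at this
    simpa [Function.comp_def, Matrix.star_eq_conjTranspose] using this
  let W : α → Matrix E Q ℂ := fun k => ∑ a, U a k • V a
  have hW : ∀ k l, (W k)ᴴ * W l
      = (if k = l then (hσ.eigenvalues k : ℂ) else 0) • (1 : Matrix Q Q ℂ) := by
    intro k l
    have h1 : (W k)ᴴ * W l = ((Uᴴ * σ * U) k l) • (1 : Matrix Q Q ℂ) := by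
      simp only [W, conjTranspose_sum, conjTranspose_smul, Matrix.sum_mul, Matrix.mul_sum,
        Matrix.smul_mul, Matrix.mul_smul, hs, smul_smul, ← Finset.sum_smul]
      congr 1
      simp only [Matrix.mul_apply, conjTranspose_apply, Finset.sum_mul, σ, Matrix.of_apply]
      refine Finset.sum_congr rfl fun a _ => ?_
      rw [Finset.mul_sum]
      refine Finset.sum_congr rfl fun b _ => ?_
      ring
    rw [h1, hdiag, Matrix.diagonal_apply]
  have hnn : ∀ k, 0 ≤ hσ.eigenvalues k := by
    intro k
    have h1 := congrFun (congrFun (hW k k) q₀) q₀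
    have h2 := (Matrix.posSemidef_conjTranspose_mul_self (W k)).diag_nonneg (i := q₀)
    rw [h1] at h2
    simpa using h2
  have hUU : ∀ a b, ∑ k, U a k * star (U b k) = if a = b then 1 else 0 := by
    intro a b
    have := congrFun (congrFun hU2 a) b
    rwa [Matrix.mul_apply, Matrix.one_apply] at this
  have hsum : ∀ X : Matrix Q Q ℂ, ∑ k, W k * X * (W k)ᴴ = ∑ a, V a * X * (V a)ᴴ := by
    intro X
    simp only [W, conjTranspose_sum, conjTranspose_smul, Matrix.sum_mul, Matrix.mul_sum,
      Matrix.smul_mul, Matrix.mul_smul, Finset.smul_sum, smul_smul]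
    rw [Finset.sum_comm]
    refine Finset.sum_congr rfl fun a _ => ?_
    rw [Finset.sum_comm]
    simp only [← Finset.sum_smul, mul_comm (star _), hUU]
    simp
  have hsum' : ∑ k, (W k)ᴴ * W k = ∑ a, (V a)ᴴ * V a := by
    simp only [W, conjTranspose_sum, conjTranspose_smul, Matrix.sum_mul, Matrix.mul_sum,
      Matrix.smul_mul, Matrix.mul_smul, Finset.smul_sum, smul_smul]
    rw [Finset.sum_comm]
    refine Finset.sum_congr rfl fun a _ => ?_
    rw [Finset.sum_comm]
    simp only [← Finset.sum_smul, hUU]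
    simp
  obtain ⟨R, hR⟩ := exists_recovery_of_orthogonal W _ hnn hW
  refine ⟨R, fun X => ?_⟩
  have hlin : ∀ g : α → Matrix E E ℂ, R.apply (∑ k, g k) = ∑ k, R.apply (g k) := by
    intro g
    simp only [Channel.apply, Matrix.mul_sum, Matrix.sum_mul]
    rw [Finset.sum_comm]
  rw [← hsum, hlin]
  simp only [hR, ← Finset.sum_smul]
  congr 1
  -- The eigenvalues sum to `c`, by comparing the two expressions for the total of the `(W k)ᴴ * W
  -- k`.
  apply hone
  rw [← hc, ← hsum', Finset.sum_smul]
  simp [hW]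

/-! ### Tensor products of channels and partial traces -/

namespace Channel

variable {a b c e : Type} [Fintype a] [DecidableEq a] [Fintype b]
  [Fintype c] [DecidableEq c] [Fintype e]

theorem sum_star_kraus_mul (Φ : Channel a b) (i j : a) :
    ∑ k, ∑ x, star (Φ.kraus k x i) * Φ.kraus k x j = if i = j then 1 else 0 := by
  have := congrFun (congrFun Φ.tracePreserving i) j
  simpa [Matrix.sum_apply, Matrix.mul_apply, Matrix.one_apply] using this

theorem apply_apply (Φ : Channel a b) (ρ : Matrix a a ℂ) (i j : b) :
    Φ.apply ρ i j = ∑ k, ∑ p, ∑ q, Φ.kraus k i p * ρ p q * star (Φ.kraus k j q) := by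
  simp only [apply, Matrix.sum_apply]
  refine Finset.sum_congr rfl fun k _ => ?_
  simp only [Matrix.mul_apply, conjTranspose_apply, Finset.sum_mul]
  rw [Finset.sum_comm]

theorem apply_smul (Φ : Channel a b) (s : ℂ) (ρ : Matrix a a ℂ) :
    Φ.apply (s • ρ) = s • Φ.apply ρ := by
  simp only [apply, Matrix.mul_smul, Matrix.smul_mul, Finset.smul_sum]

/-- The reference is untouched, so a state can be followed one reference block at a time. -/
theorem id_tensor_apply_submatrix (Φ : Channel a b) (ρ : Matrix (c × a) (c × a) ℂ) (q q' : c) :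
    (((Channel.id c).tensor Φ).apply ρ).submatrix (Prod.mk q) (Prod.mk q')
      = Φ.apply (ρ.submatrix (Prod.mk q) (Prod.mk q')) := by
  ext i j
  have hid : (Channel.id c).kraus PUnit.unit = 1 := rfl
  rw [submatrix_apply, apply_apply, apply_apply]
  change ∑ k : Unit × Φ.κ, _ = _
  simp only [Fintype.sum_prod_type, tensor, kroneckerMap_apply, Matrix.submatrix_apply]
  simp only [Finset.univ_unique, Finset.sum_singleton]
  refine Finset.sum_congr rfl fun k _ => ?_
  rw [Finset.sum_eq_single q]
  · refine Finset.sum_congr rfl fun p _ => ?_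
    rw [Finset.sum_eq_single q']
    · simp [hid]
    · intro r _ hr
      simp [hid, hr.symm]
    · simp
  · intro r _ hr
    simp [hid, Matrix.one_apply, hr.symm]
  · simp

/-- No-signalling: summing over the output of `Φ` collapses its Kraus operators by trace
preservation. -/
theorem traceLeft_tensor_apply (Φ : Channel a b) (Ψ : Channel c e)
    (ρ : Matrix (a × c) (a × c) ℂ) :
    traceLeft ((Φ.tensor Ψ).apply ρ) = Ψ.apply (traceLeft ρ) := by
  ext i j
  simp only [traceLeft, Matrix.of_apply, apply_apply]
  change ∑ x, ∑ k : Φ.κ × Ψ.κ, _ = _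
  simp only [Fintype.sum_prod_type, tensor, kroneckerMap_apply, star_mul']
  have h : ∀ k' p p' q q', ∑ x, ∑ k, Φ.kraus k x p * Ψ.kraus k' i p' * ρ (p, p') (q, q') *
      (star (Φ.kraus k x q) * star (Ψ.kraus k' j q')) =
      if q = p then Ψ.kraus k' i p' * ρ (p, p') (q, q') * star (Ψ.kraus k' j q') else 0 := by
    intro k' p p' q q'
    have h1 : ∀ x k, Φ.kraus k x p * Ψ.kraus k' i p' * ρ (p, p') (q, q') *
        (star (Φ.kraus k x q) * star (Ψ.kraus k' j q')) =
        (star (Φ.kraus k x q) * Φ.kraus k x p) *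
          (Ψ.kraus k' i p' * ρ (p, p') (q, q') * star (Ψ.kraus k' j q')) := by
      intro x k; ring
    simp only [h1, ← Finset.sum_mul]
    rw [Finset.sum_comm, sum_star_kraus_mul]
    simp
  -- Bundling the indices lets one exchange of sums bring the indices of `Φ` innermost.
  let F : b × Φ.κ → Ψ.κ × (a × c) × (a × c) → ℂ := fun w t =>
    Φ.kraus w.2 w.1 t.2.1.1 * Ψ.kraus t.1 i t.2.1.2 * ρ t.2.1 t.2.2 *
      (star (Φ.kraus w.2 w.1 t.2.2.1) * star (Ψ.kraus t.1 j t.2.2.2))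
  calc _ = ∑ w, ∑ t, F w t := by simp only [Fintype.sum_prod_type, F]
    _ = ∑ t, ∑ w, F w t := Finset.sum_comm
    _ = ∑ k', ∑ p, ∑ p', ∑ q, ∑ q', ∑ x, ∑ k, Φ.kraus k x p * Ψ.kraus k' i p' *
        ρ (p, p') (q, q') * (star (Φ.kraus k x q) * star (Ψ.kraus k' j q')) := by
        simp only [Fintype.sum_prod_type, F]
    _ = _ := by
        simp only [h]
        refine Finset.sum_congr rfl fun k' _ => ?_
        rw [Finset.sum_comm]
        refine Finset.sum_congr rfl fun p' _ => ?_
        simp only [Finset.mul_sum, Finset.sum_mul]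
        have h2 : ∀ p : a, ∑ q, ∑ q', (if q = p then Ψ.kraus k' i p' * ρ (p, p') (q, q') *
            star (Ψ.kraus k' j q') else 0) = ∑ q', Ψ.kraus k' i p' * ρ (p, p') (p, q') *
            star (Ψ.kraus k' j q') := by
          intro p
          rw [Finset.sum_eq_single p]
          · simp
          · intro q _ hq
            simp [hq]
          · simp
        simp only [h2]
        rw [Finset.sum_comm]

theorem tensor_apply_swap (Φ : Channel a b) (Ψ : Channel c e)
    (ρ : Matrix (a × c) (a × c) ℂ) :
    ((Φ.tensor Ψ).apply ρ).submatrix Prod.swap Prod.swap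
      = (Ψ.tensor Φ).apply (ρ.submatrix Prod.swap Prod.swap) := by
  ext i j
  rw [submatrix_apply, apply_apply, apply_apply]
  refine Fintype.sum_equiv (Equiv.prodComm Φ.κ Ψ.κ) _ _ fun k => ?_
  refine Fintype.sum_equiv (Equiv.prodComm a c) _ _ fun p => ?_
  refine Fintype.sum_equiv (Equiv.prodComm a c) _ _ fun q => ?_
  simp [tensor, mul_comm]

theorem traceRight_tensor_apply (Φ : Channel a b) (Ψ : Channel c e)
    (ρ : Matrix (a × c) (a × c) ℂ) :
    traceRight ((Φ.tensor Ψ).apply ρ) = Φ.apply (traceRight ρ) := by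
  have h := traceLeft_tensor_apply Ψ Φ (ρ.submatrix Prod.swap Prod.swap)
  rw [← tensor_apply_swap] at h
  exact h

end Channel

/-! ### Final states in terms of the operators of the communication round -/

namespace RoutingProtocol

variable {n d : ℕ} (P : RoutingProtocol n d) (x y : Fin n → Bool)

/-- The operator from `Q` to the systems held on the left and on the right after the
communication, contracted with the unnormalized resource `∑ l, |l⟩ ⊗ |l⟩`, for given Kraus
operators of the first round. -/
def roundOp (k : (P.first₀ x).κ × (P.first₁ y).κ) :
    Matrix ((P.K₀ × P.M₁) × (P.M₀ × P.K₁)) (Fin d) ℂ :=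
  Matrix.of fun p c => ∑ l, (P.first₀ x).kraus k.1 (p.1.1, p.2.1) (c, l) *
    (P.first₁ y).kraus k.2 (p.1.2, p.2.2) l

/-- The operators taking `Q` to the right side when everything on the left is traced out. -/
def rightOp (t : ((P.first₀ x).κ × (P.first₁ y).κ) × (P.K₀ × P.M₁)) :
    Matrix (P.M₀ × P.K₁) (Fin d) ℂ :=
  (P.roundOp x y t.1).submatrix (fun r => (t.2, r)) _root_.id

/-- The operators taking `Q` to the left side when everything on the right is traced out. -/
def leftOp (t : ((P.first₀ x).κ × (P.first₁ y).κ) × (P.M₀ × P.K₁)) :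
    Matrix (P.K₀ × P.M₁) (Fin d) ℂ :=
  (P.roundOp x y t.1).submatrix (fun l => (l, t.2)) _root_.id

/-- Both first operations preserve trace; the factor is the squared norm of the unnormalized
resource. -/
theorem sum_star_roundOp_mul (c c' : Fin d) :
    ∑ k, ∑ p, star (P.roundOp x y k p c) * P.roundOp x y k p c'
      = if c = c' then (Fintype.card P.L : ℂ) else 0 := by
  let F : (((P.first₀ x).κ × (P.K₀ × P.M₀)) × ((P.first₁ y).κ × (P.M₁ × P.K₁))) →
      P.L × P.L → ℂ := fun w l =>
    (star ((P.first₀ x).kraus w.1.1 w.1.2 (c, l.1)) * (P.first₀ x).kraus w.1.1 w.1.2 (c', l.2)) *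
    (star ((P.first₁ y).kraus w.2.1 w.2.2 l.1) * (P.first₁ y).kraus w.2.1 w.2.2 l.2)
  calc _ = ∑ k : (P.first₀ x).κ × (P.first₁ y).κ, ∑ p : (P.K₀ × P.M₁) × (P.M₀ × P.K₁), ∑ l,
        F ((k.1, (p.1.1, p.2.1)), (k.2, (p.1.2, p.2.2))) l := by
        refine Finset.sum_congr rfl fun k _ => Finset.sum_congr rfl fun p _ => ?_
        simp only [roundOp, Matrix.of_apply, star_sum, Finset.sum_mul_sum, star_mul',
          Fintype.sum_prod_type, F]
        refine Finset.sum_congr rfl fun l _ => Finset.sum_congr rfl fun l' _ => ?_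
        ring
    _ = ∑ w, ∑ l, F w l := by
        rw [← Fintype.sum_prod_type']
        exact Fintype.sum_equiv
          { toFun := fun z => ((z.1.1, (z.2.1.1, z.2.2.1)), (z.1.2, (z.2.1.2, z.2.2.2)))
            invFun := fun w => ((w.1.1, w.2.1), ((w.1.2.1, w.2.2.1), (w.1.2.2, w.2.2.2)))
            left_inv := fun _ => rfl
            right_inv := fun _ => rfl } _ _ fun z => rfl
    _ = ∑ l, ∑ w, F w l := Finset.sum_comm
    _ = ∑ l : P.L × P.L, (if (c, l.1) = (c', l.2) then 1 else 0) *
          (if l.1 = l.2 then 1 else 0) := by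
        refine Finset.sum_congr rfl fun l _ => ?_
        rw [← (P.first₀ x).sum_star_kraus_mul, ← (P.first₁ y).sum_star_kraus_mul,
          ← Fintype.sum_prod_type', ← Fintype.sum_prod_type', Finset.sum_mul_sum,
          Fintype.sum_prod_type]
    _ = _ := by
        rw [Fintype.sum_prod_type]
        by_cases h : c = c' <;> simp [h]

theorem sum_rightOp : ∑ t, (P.rightOp x y t)ᴴ * P.rightOp x y t
    = (Fintype.card P.L : ℂ) • (1 : Matrix (Fin d) (Fin d) ℂ) := by
  ext c c'
  calc _ = ∑ k, ∑ l, ∑ r, star (P.roundOp x y k (l, r) c) * P.roundOp x y k (l, r) c' := by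
        rw [Matrix.sum_apply, Fintype.sum_prod_type]
        rfl
    _ = ∑ k, ∑ p, star (P.roundOp x y k p c) * P.roundOp x y k p c' := by
        exact Finset.sum_congr rfl fun k _ =>
          (Fintype.sum_prod_type fun p => star (P.roundOp x y k p c) * P.roundOp x y k p c').symm
    _ = _ := by
        rw [sum_star_roundOp_mul, Matrix.smul_apply, Matrix.one_apply]
        simp

theorem sum_leftOp : ∑ t, (P.leftOp x y t)ᴴ * P.leftOp x y t
    = (Fintype.card P.L : ℂ) • (1 : Matrix (Fin d) (Fin d) ℂ) := by
  ext c c'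
  calc _ = ∑ k, ∑ r, ∑ l, star (P.roundOp x y k (l, r) c) * P.roundOp x y k (l, r) c' := by
        rw [Matrix.sum_apply, Fintype.sum_prod_type]
        rfl
    _ = ∑ k, ∑ p, star (P.roundOp x y k p c) * P.roundOp x y k p c' := by
        refine Finset.sum_congr rfl fun k _ => ?_
        rw [Finset.sum_comm]
        exact (Fintype.sum_prod_type fun p => star (P.roundOp x y k p c) * P.roundOp x y k p c').symm
    _ = _ := by
        rw [sum_star_roundOp_mul, Matrix.smul_apply, Matrix.one_apply]
        simp

/-- The joint state of the two sides after the communication, in the block of the reference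
system given by `q` and `q'`. -/
def exchanged (q q' : Fin d) :
    Matrix ((P.K₀ × P.M₁) × (P.M₀ × P.K₁)) ((P.K₀ × P.M₁) × (P.M₀ × P.K₁)) ℂ :=
  ((d : ℂ)⁻¹ * (Fintype.card P.L : ℂ)⁻¹) •
    ∑ k, P.roundOp x y k * Matrix.single q q' (1 : ℂ) * (P.roundOp x y k)ᴴ

/-- A reference block of the maximally entangled state is a multiple of a matrix unit, so each block
evolves as that matrix unit on `Q`. -/
theorem finalState_submatrix (q q' : Fin d) :
    (P.finalState x y).submatrix (Prod.mk q) (Prod.mk q')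
      = ((P.second₀ x y).tensor (P.second₁ x y)).apply (P.exchanged x y q q') := by
  rw [finalState, Channel.id_tensor_apply_submatrix]
  congr 1
  have h : (((Channel.id (Fin d)).tensor ((P.first₀ x).tensor (P.first₁ y))).apply
      P.initialState).submatrix (Prod.mk q) (Prod.mk q') =
      ((P.first₀ x).tensor (P.first₁ y)).apply
        (P.initialState.submatrix (Prod.mk q) (Prod.mk q')) :=
    Channel.id_tensor_apply_submatrix _ _ _ _
  ext i j
  have h' := congrFun (congrFun h ((i.1.1, i.2.1), (i.1.2, i.2.2)))
    ((j.1.1, j.2.1), (j.1.2, j.2.2))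
  refine Eq.trans h' ?_
  rw [Channel.apply_apply, exchanged, Matrix.smul_apply, Matrix.sum_apply, smul_eq_mul,
    Finset.mul_sum]
  change ∑ k : (P.first₀ x).κ × (P.first₁ y).κ, _ = _
  refine Finset.sum_congr rfl fun k _ => ?_
  have h1 : (P.roundOp x y k * Matrix.single q q' (1 : ℂ) * (P.roundOp x y k)ᴴ) i j
      = P.roundOp x y k i q * star (P.roundOp x y k j q') := by
    rw [Matrix.mul_apply, Finset.sum_eq_single q']
    · simp
    · intro r _ hr
      simp [Matrix.mul_single_apply_of_ne _ _ _ _ _ hr]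
    · simp
  rw [h1]
  simp only [roundOp, Matrix.of_apply, star_sum, Finset.sum_mul_sum]
  simp only [Finset.mul_sum]
  simp only [Fintype.sum_prod_type, initialState, Matrix.submatrix_apply, inputEquiv,
    Equiv.coe_fn_mk, kroneckerMap_apply, maxEntangled, Matrix.of_apply, Fintype.card_fin,
    Channel.tensor]
  rw [Finset.sum_eq_single q]
  · refine Finset.sum_congr rfl fun l _ => ?_
    rw [Finset.sum_eq_single l]
    · rw [Finset.sum_eq_single q']
      · refine Finset.sum_congr rfl fun l' _ => ?_
        rw [Finset.sum_eq_single l']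
        · simp
          ring
        · intro r _ hr
          simp [hr.symm]
        · simp
      · intro r _ hr
        simp [hr.symm]
      · simp
    · intro r _ hr
      simp [hr.symm]
    · simp
  · intro r _ hr
    simp [hr.symm]
  · simp

/-- By no-signalling the left's second operation disappears under the trace; a recovery working on
all matrix units then restores every reference block. -/
theorem outputState_true_of_recovers
    (h : ∀ X, (P.second₁ x y).apply (∑ t, P.rightOp x y t * X * (P.rightOp x y t)ᴴ)
      = (Fintype.card P.L : ℂ) • X) :
    P.outputState x y true = maxEntangled (Fin d) := by
  ext ⟨q, b⟩ ⟨q', b'⟩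
  have h1 : P.outputState x y true (q, b) (q', b')
      = traceLeft ((P.finalState x y).submatrix (Prod.mk q) (Prod.mk q')) b b' := rfl
  have h2 : traceLeft (P.exchanged x y q q') = ((d : ℂ)⁻¹ * (Fintype.card P.L : ℂ)⁻¹) •
      ∑ t, P.rightOp x y t * Matrix.single q q' (1 : ℂ) * (P.rightOp x y t)ᴴ := by
    ext i j
    simp only [traceLeft, exchanged, Matrix.of_apply, Matrix.smul_apply, Matrix.sum_apply,
      ← Finset.smul_sum]
    rw [Finset.sum_comm, ← Fintype.sum_prod_type']
    rfl
  rw [h1, finalState_submatrix, Channel.traceLeft_tensor_apply, h2, Channel.apply_smul, h,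
    smul_smul, mul_assoc, inv_mul_cancel₀ (by simp), mul_one]
  simp [maxEntangled, Matrix.single_apply]

theorem outputState_false_of_recovers
    (h : ∀ X, (P.second₀ x y).apply (∑ t, P.leftOp x y t * X * (P.leftOp x y t)ᴴ)
      = (Fintype.card P.L : ℂ) • X) :
    P.outputState x y false = maxEntangled (Fin d) := by
  ext ⟨q, b⟩ ⟨q', b'⟩
  have h1 : P.outputState x y false (q, b) (q', b')
      = traceRight ((P.finalState x y).submatrix (Prod.mk q) (Prod.mk q')) b b' := rfl
  have h2 : traceRight (P.exchanged x y q q') = ((d : ℂ)⁻¹ * (Fintype.card P.L : ℂ)⁻¹) •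
      ∑ t, P.leftOp x y t * Matrix.single q q' (1 : ℂ) * (P.leftOp x y t)ᴴ := by
    ext i j
    simp only [traceRight, exchanged, Matrix.of_apply, Matrix.smul_apply, Matrix.sum_apply,
      ← Finset.smul_sum]
    rw [Finset.sum_comm, ← Fintype.sum_prod_type']
    rfl
  rw [h1, finalState_submatrix, Channel.traceRight_tensor_apply, h2, Channel.apply_smul, h,
    smul_smul, mul_assoc, inv_mul_cancel₀ (by simp), mul_one]
  simp [maxEntangled, Matrix.single_apply]

theorem completes_of_outputState (hd : 0 < d) (f : (Fin n ⊕ Fin n → Bool) → Bool)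
    (h : ∀ x y, P.outputState x y (f (Sum.elim x y)) = maxEntangled (Fin d)) :
    P.Completes f := by
  have hd' : (d : ℂ) ≠ 0 := by exact_mod_cast hd.ne'
  have h1 : (maxEntangled (Fin d) * maxEntangled (Fin d)).trace = 1 := by
    simp only [Matrix.trace, Matrix.diag_apply, Matrix.mul_apply, Fintype.sum_prod_type,
      maxEntangled, Matrix.of_apply, Fintype.card_fin]
    simp [ite_and, hd']
  simp only [Completes, successProb, h, h1]
  simp

end RoutingProtocol

/-! ### Necessity of the Knill–Laflamme condition -/

section Span

open scoped MatrixOrder Matrix.Norms.L2Operator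

theorem span_posSemidef (Q : Type) [Fintype Q] [DecidableEq Q] :
    Submodule.span ℂ {ρ : Matrix Q Q ℂ | ρ.PosSemidef} = ⊤ := by
  have h := CStarAlgebra.span_nonneg (A := Matrix Q Q ℂ)
  simpa only [Matrix.nonneg_iff_posSemidef] using h

end Span

/-- A linear map vanishing on all density matrices vanishes. -/
theorem linearMap_eq_zero_of_isState {Q Z : Type} [Fintype Q] [DecidableEq Q] [AddCommGroup Z]
    [Module ℂ Z] (T : Matrix Q Q ℂ →ₗ[ℂ] Z) (h : ∀ ρ, IsState ρ → T ρ = 0) : T = 0 := by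
  refine LinearMap.ext_on (span_posSemidef Q) fun ρ (hρ : ρ.PosSemidef) => ?_
  have ht := hρ.trace_nonneg
  by_cases h0 : ρ.trace = 0
  · rw [hρ.trace_eq_zero_iff] at h0
    simp [h0]
  · have hs : IsState (ρ.trace⁻¹ • ρ) :=
      ⟨hρ.smul (inv_nonneg.2 ht), by rw [Matrix.trace_smul, smul_eq_mul, inv_mul_cancel₀ h0]⟩
    have := h _ hs
    rw [map_smul, smul_eq_zero] at this
    simpa [h0] using this

/-- The Kraus operators of the identity map are multiples of the identity. -/
theorem kraus_eq_smul_one {Q α : Type} [Fintype Q] [DecidableEq Q] [Fintype α]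
    (T : α → Matrix Q Q ℂ) (h : ∀ X, ∑ a, T a * X * (T a)ᴴ = X) (a : α) :
    ∃ c : ℂ, T a = c • (1 : Matrix Q Q ℂ) := by
  -- Evaluating on matrix units gives all inner products of the entries `T · p i`, seen as vectors
  -- indexed by `α`.
  have h1 : ∀ i j p p', ∑ a, T a p i * star (T a p' j) = if p = i ∧ p' = j then 1 else 0 := by
    intro i j p p'
    have h2 := congrFun (congrFun (h (Matrix.single i j 1)) p) p'
    rw [Matrix.sum_apply] at h2
    simp only [Matrix.single_apply] at h2
    rw [show (if p = i ∧ p' = j then (1 : ℂ) else 0) = if i = p ∧ j = p' then 1 else 0 by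
      simp only [eq_comm], ← h2]
    refine Finset.sum_congr rfl fun a _ => ?_
    rw [Matrix.mul_apply, Finset.sum_eq_single j]
    · simp
    · intro r _ hr
      simp [Matrix.mul_single_apply_of_ne _ _ _ _ _ hr]
    · simp
  have key : ∀ g : α → ℂ, ∑ a, g a * star (g a) = 0 → g a = 0 := by
    intro g hg
    have h3 : ∑ a, Complex.normSq (g a) = 0 := by
      have : ((∑ a, Complex.normSq (g a) : ℝ) : ℂ) = 0 := by
        rw [← hg, Complex.ofReal_sum]
        exact Finset.sum_congr rfl fun a _ => (Complex.mul_conj _).symm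
      exact_mod_cast this
    rw [Finset.sum_eq_zero_iff_of_nonneg fun _ _ => Complex.normSq_nonneg _] at h3
    exact Complex.normSq_eq_zero.1 (h3 a (Finset.mem_univ a))
  rcases isEmpty_or_nonempty Q with hQ | ⟨⟨q₀⟩⟩
  · exact ⟨0, Subsingleton.elim _ _⟩
  refine ⟨T a q₀ q₀, ?_⟩
  ext p q
  rw [Matrix.smul_apply, Matrix.one_apply]
  by_cases hpq : p = q
  · subst hpq
    -- The squared norm of this difference is `1 - 1 - 1 + 1 = 0`, so the diagonal entries agree.
    have := key (fun a => T a p p - T a q₀ q₀) (by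
      simp only [star_sub, sub_mul, mul_sub, Finset.sum_sub_distrib, h1]
      simp)
    simpa [sub_eq_zero] using this
  · have := key (fun a => T a p q) (by rw [h1]; simp [hpq])
    simpa [hpq] using this

/-- Error operators that can be undone satisfy the Knill–Laflamme condition. -/
theorem exists_smul_one_of_recovers {E Q α : Type} [Fintype E] [DecidableEq E] [Fintype Q]
    [DecidableEq Q] [Fintype α] (V : α → Matrix E Q ℂ) (R : Channel E Q)
    (h : ∀ X, R.apply (∑ a, V a * X * (V a)ᴴ) = X) (a b : α) :
    ∃ s : ℂ, (V a)ᴴ * V b = s • (1 : Matrix Q Q ℂ) := by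
  have h1 : ∀ X, ∑ t : R.κ × α, (R.kraus t.1 * V t.2) * X * (R.kraus t.1 * V t.2)ᴴ = X := by
    intro X
    conv_rhs => rw [← h X]
    rw [Fintype.sum_prod_type]
    simp only [Channel.apply, Matrix.mul_sum, Matrix.sum_mul, conjTranspose_mul,
      Matrix.mul_assoc]
  choose c hc using kraus_eq_smul_one _ h1
  refine ⟨∑ k, star (c (k, a)) * c (k, b), ?_⟩
  calc (V a)ᴴ * V b = (V a)ᴴ * (∑ k, (R.kraus k)ᴴ * R.kraus k) * V b := by
        rw [R.tracePreserving, Matrix.mul_one]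
    _ = ∑ k, (R.kraus k * V a)ᴴ * (R.kraus k * V b) := by
        simp only [Matrix.mul_sum, Matrix.sum_mul, conjTranspose_mul, Matrix.mul_assoc]
    _ = _ := by
        rw [Finset.sum_smul]
        refine Finset.sum_congr rfl fun k _ => ?_
        rw [hc (k, a), hc (k, b)]
        simp [smul_smul, mul_comm]

/-! ### Authorization and secrecy as identities between Kraus entries -/

namespace SharingScheme

variable {ι : Type} [Fintype ι] [DecidableEq ι] {d : ℕ} (S : SharingScheme ι d) (z : ι → Bool)

/-- The basis of the joint system of the shares `S i` with `z i = 0`. -/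
abbrev OtherShares : Type :=
  (i : {i // ¬z i = true}) → Fin (S.dim i)

/-- The basis vector of all shares with given parts in `z` and in its complement. -/
abbrev glue (r : S.Shares z) (l : S.OtherShares z) : (i : ι) → Fin (S.dim i) :=
  (Equiv.piEquivPiSubtypeProd (fun i => z i = true) (fun i => Fin (S.dim i))).symm (r, l)

theorem reduced_apply (ρ : Matrix (Fin d) (Fin d) ℂ) (r r' : S.Shares z) :
    S.reduced z ρ r r' = ∑ l, S.encode.apply ρ (S.glue z r l) (S.glue z r' l) := rfl

/-- `S.reduced z` as a linear map. -/
def reducedLinear : Matrix (Fin d) (Fin d) ℂ →ₗ[ℂ] Matrix (S.Shares z) (S.Shares z) ℂ where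
  toFun := S.reduced z
  map_add' ρ τ := by
    ext r r'
    simp only [Matrix.add_apply, reduced_apply, Channel.apply, Matrix.mul_add, Matrix.add_mul,
      Finset.sum_add_distrib]
  map_smul' s ρ := by
    ext r r'
    simp only [Matrix.smul_apply, reduced_apply, Channel.apply_smul, RingHom.id_apply,
      Finset.smul_sum]

theorem reduced_eq_sum (ρ : Matrix (Fin d) (Fin d) ℂ) :
    S.reduced z ρ = ∑ t : S.OtherShares z × S.encode.κ,
      (S.encode.kraus t.2).submatrix (fun r => S.glue z r t.1) id * ρ *
        ((S.encode.kraus t.2).submatrix (fun r => S.glue z r t.1) id)ᴴ := by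
  ext r r'
  rw [reduced_apply, Matrix.sum_apply, Fintype.sum_prod_type]
  refine Finset.sum_congr rfl fun l _ => ?_
  rw [Channel.apply, Matrix.sum_apply]
  rfl

/-- The reduced state has Kraus operators labelled by the traced-out shares and the environment;
their recoverability forces the Knill–Laflamme scalars. -/
theorem Authorized.exists_sum_eq {S : SharingScheme ι d} {z : ι → Bool} (h : S.Authorized z)
    (l l' : S.OtherShares z) (e e' : S.encode.κ) :
    ∃ s : ℂ, ∀ q q', ∑ r, star (S.encode.kraus e (S.glue z r l) q) *
      S.encode.kraus e' (S.glue z r l') q' = if q = q' then s else 0 := by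
  obtain ⟨R, hR⟩ := h
  -- Recovery is known on states only; linearity extends it to all matrices.
  let T : Matrix (Fin d) (Fin d) ℂ →ₗ[ℂ] Matrix (Fin d) (Fin d) ℂ :=
    { toFun := fun ρ => R.apply (S.reducedLinear z ρ) - ρ
      map_add' := fun ρ τ => by
        simp only [map_add, Channel.apply, Matrix.mul_add, Matrix.add_mul,
          Finset.sum_add_distrib]
        abel
      map_smul' := fun s ρ => by
        simp only [map_smul, Channel.apply_smul, smul_sub, RingHom.id_apply] }
  have hT : T = 0 := linearMap_eq_zero_of_isState T fun ρ hρ => sub_eq_zero.2 (hR ρ hρ)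
  have hX : ∀ X, R.apply (S.reduced z X) = X := fun X =>
    sub_eq_zero.1 (LinearMap.congr_fun hT X)
  simp only [reduced_eq_sum] at hX
  obtain ⟨s, hs⟩ := exists_smul_one_of_recovers _ R hX (l, e) (l', e')
  refine ⟨s, fun q q' => ?_⟩
  have := congrFun (congrFun hs q) q'
  rw [Matrix.mul_apply, Matrix.smul_apply, Matrix.one_apply] at this
  simpa using this

/-- Linearity extends a constant reduced state to `X ↦ X.trace • σ`. On matrix units this is the
Knill–Laflamme condition for the remaining shares together with the environment. -/
theorem Unauthorized.exists_sum_eq {S : SharingScheme ι d} {z : ι → Bool}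
    (h : S.Unauthorized z) (r r' : S.Shares z) :
    ∃ s : ℂ, ∀ q q', ∑ l, ∑ e, star (S.encode.kraus e (S.glue z r l) q) *
      S.encode.kraus e (S.glue z r' l) q' = if q = q' then s else 0 := by
  obtain ⟨σ, hσ⟩ := h
  let T : Matrix (Fin d) (Fin d) ℂ →ₗ[ℂ] Matrix (S.Shares z) (S.Shares z) ℂ :=
    S.reducedLinear z - (Matrix.traceLinearMap (Fin d) ℂ ℂ).smulRight σ
  have hT : T = 0 := linearMap_eq_zero_of_isState T fun ρ hρ => by
    have : S.reduced z ρ = σ := hσ ρ hρ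
    simp [T, reducedLinear, this, hρ.2]
  refine ⟨σ r' r, fun q q' => ?_⟩
  have h1 : S.reduced z (Matrix.single q' q 1) = (Matrix.single q' q (1 : ℂ)).trace • σ :=
    sub_eq_zero.1 (LinearMap.congr_fun hT (Matrix.single q' q 1))
  have h2 := congrFun (congrFun h1 r') r
  rw [reduced_apply, Matrix.smul_apply] at h2
  calc _ = ∑ l, S.encode.apply (Matrix.single q' q 1) (S.glue z r' l) (S.glue z r l) := by
        refine Finset.sum_congr rfl fun l _ => ?_
        rw [Channel.apply, Matrix.sum_apply]
        refine Finset.sum_congr rfl fun e _ => ?_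
        rw [Matrix.mul_apply, Finset.sum_eq_single q]
        · simp [mul_comm]
        · intro p _ hp
          simp [Matrix.mul_single_apply_of_ne _ _ _ _ _ hp]
        · simp
    _ = _ := by
        rw [h2]
        by_cases hq : q = q'
        · subst hq
          simp
        · rw [Matrix.trace_single_eq_of_ne _ _ _ (Ne.symm hq)]
          simp [hq]

end SharingScheme

/-! ### Choosing the second operations -/

/-- If on all inputs the operators to the side `f (x, y)` satisfy the Knill–Laflamme
condition, then the second operations can be chosen so that the task is completed. -/
theorem RoutingProtocol.exists_completes {n d : ℕ} (hd : 0 < d) (P : RoutingProtocol n d)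
    (f : (Fin n ⊕ Fin n → Bool) → Bool)
    (h₁ : ∀ x y, f (Sum.elim x y) = true → ∀ t t', ∃ s : ℂ,
      (P.rightOp x y t)ᴴ * P.rightOp x y t' = s • (1 : Matrix (Fin d) (Fin d) ℂ))
    (h₀ : ∀ x y, f (Sum.elim x y) = false → ∀ t t', ∃ s : ℂ,
      (P.leftOp x y t)ᴴ * P.leftOp x y t' = s • (1 : Matrix (Fin d) (Fin d) ℂ)) :
    ∃ P' : RoutingProtocol n d, P'.Completes f ∧ Fintype.card P'.L = Fintype.card P.L := by
  have : Nonempty (Fin d) := ⟨⟨0, hd⟩⟩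
  have hR : ∀ x y, ∃ R : Channel (P.M₀ × P.K₁) (Fin d), f (Sum.elim x y) = true →
      ∀ X, R.apply (∑ t, P.rightOp x y t * X * (P.rightOp x y t)ᴴ)
        = (Fintype.card P.L : ℂ) • X := by
    intro x y
    by_cases hf : f (Sum.elim x y) = true
    · obtain ⟨R, h⟩ := exists_recovery _ (h₁ x y hf) _ (P.sum_rightOp x y)
      exact ⟨R, fun _ => h⟩
    · exact ⟨P.second₁ x y, fun h => absurd h hf⟩
  have hL : ∀ x y, ∃ R : Channel (P.K₀ × P.M₁) (Fin d), f (Sum.elim x y) = false →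
      ∀ X, R.apply (∑ t, P.leftOp x y t * X * (P.leftOp x y t)ᴴ)
        = (Fintype.card P.L : ℂ) • X := by
    intro x y
    by_cases hf : f (Sum.elim x y) = false
    · obtain ⟨R, h⟩ := exists_recovery _ (h₀ x y hf) _ (P.sum_leftOp x y)
      exact ⟨R, fun _ => h⟩
    · exact ⟨P.second₀ x y, fun h => absurd h hf⟩
  choose R hR using hR
  choose T hT using hL
  let P' : RoutingProtocol n d := { P with second₀ := T, second₁ := R }
  refine ⟨P', P'.completes_of_outputState hd f fun x y => ?_, rfl⟩
  cases hf : f (Sum.elim x y)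
  · exact P'.outputState_false_of_recovers x y (hT x y hf)
  · exact P'.outputState_true_of_recovers x y (hR x y hf)

/-- Recovery from an empty family of errors. It supplies placeholder second operations, later
replaced. -/
theorem nonempty_channel (a b : Type) [Fintype a] [DecidableEq a] [Fintype b] [DecidableEq b]
    [Nonempty b] : Nonempty (Channel a b) := by
  obtain ⟨R, -⟩ := exists_recovery (E := a) (Q := b) (α := Empty) (fun t => t.elim)
    (fun t => t.elim) 0 (by simp)
  exact ⟨R⟩

/-! ### Teleportation without correction -/

/-- A vector is determined by its part in the range of a projection and the rest. -/
theorem sum_sum_ite_map_add {A : Type} [AddCommGroup A] [Fintype A] [DecidableEq A]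
    (p : A →+ A) (g : A → ℂ) :
    ∑ a₀, ∑ a₁, (if p (a₀ + a₁) = a₁ then g (a₀ + a₁) else 0) = ∑ a, g a := by
  rw [Finset.sum_comm]
  have h : ∀ a₁, ∑ a₀, (if p (a₀ + a₁) = a₁ then g (a₀ + a₁) else 0)
      = ∑ a, if p a = a₁ then g a else 0 := fun a₁ =>
    Equiv.sum_comp (Equiv.addRight a₁) fun a => if p a = a₁ then g a else 0
  simp only [h]
  rw [Finset.sum_comm]
  simp

theorem sum_registers {α β M : Type} [Fintype α] [Fintype β] [Fintype M] (m : M)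
    (F : (α × M) × (β × M) → ℂ) (h : ∀ p, ¬(p.1.2 = m ∧ p.2.2 = m) → F p = 0) :
    ∑ p, F p = ∑ u, ∑ v, F ((u, m), (v, m)) := by
  simp only [Fintype.sum_prod_type]
  refine Finset.sum_congr rfl fun u _ => ?_
  rw [Finset.sum_eq_single m]
  · refine Finset.sum_congr rfl fun v _ => ?_
    rw [Finset.sum_eq_single m]
    · intro m' _ hm
      exact h _ fun hp => hm hp.2
    · simp
  · intro m' _ hm
    exact Finset.sum_eq_zero fun v _ => Finset.sum_eq_zero fun m'' _ => h _ fun hp => hm hp.1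
  · simp

theorem addChar_star_mul {B : Type} [AddCommGroup B] [Finite B] (χ : AddChar B ℂ) (a b : B) :
    star (χ a) * χ b = χ (b - a) := by
  rw [sub_eq_add_neg, AddChar.map_add_eq_mul, AddChar.map_neg_eq_conj, mul_comm]
  rfl

section Teleport

/-- Normalization of the Bell basis. -/
def bellNorm (B : Type) [Fintype B] : ℂ := ((Real.sqrt (Fintype.card B) : ℝ) : ℂ)⁻¹

theorem star_bellNorm_mul (B : Type) [Fintype B] [Nonempty B] :
    star (bellNorm B) * bellNorm B * Fintype.card B = 1 := by
  have h : ((Real.sqrt (Fintype.card B) : ℝ) : ℂ) * ((Real.sqrt (Fintype.card B) : ℝ) : ℂ)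
      = Fintype.card B := by
    rw [← Complex.ofReal_mul, Real.mul_self_sqrt (by positivity)]
    simp
  have h0 : (Fintype.card B : ℂ) ≠ 0 := by simp
  have h1 : star (bellNorm B) = bellNorm B := by simp [bellNorm]
  rw [h1, bellNorm, ← mul_inv, h, inv_mul_cancel₀ h0]

variable {n d : ℕ} {A B κ : Type} [AddCommGroup A] [Fintype A] [DecidableEq A]
  [AddCommGroup B] [Fintype B] [Fintype κ]

/-- Labels of the outcomes of a Bell measurement on two copies of the system with basis `B`. -/
abbrev BellLabel (B : Type) [AddCommGroup B] : Type := B × AddChar B ℂ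

instance : DecidableEq (BellLabel B) := Classical.decEq _

/-- The Kraus operator of the sender for the Bell outcome `k.1`, the `A`-part of the resource
being found in the basis state `k.2`: apply the isometry `V`, split the `A`-part into a kept
and a sent part according to `p`, and copy the Bell outcome to both parts. -/
def senderKraus (V : A → B → κ → Fin d → ℂ) (p : A →+ A) (k : BellLabel B × A) :
    Matrix (((A × κ) × BellLabel B) × (A × BellLabel B)) (Fin d × (A × B)) ℂ :=
  Matrix.of fun o i =>
    if o.1.2 = k.1 ∧ o.2.2 = k.1 ∧ i.2.1 = k.2 ∧ p (o.1.1.1 + o.2.1) = o.2.1 then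
      bellNorm B * k.1.2 (k.1.1 - i.2.2) * V (o.1.1.1 + o.2.1) (i.2.2 - k.1.1) o.1.1.2 i.1
    else 0

/-- `V` is an isometry. -/
def IsIsometry (V : A → B → κ → Fin d → ℂ) : Prop :=
  ∀ q q', ∑ a, ∑ b, ∑ e, star (V a b e q) * V a b e q' = if q = q' then 1 else 0

/-- Splitting `A` by `p` preserves inner products, and the two phases combine to one depending only
on `v - v'`. -/
theorem sum_star_senderKraus_mul (V : A → B → κ → Fin d → ℂ) (p : A →+ A)
    (j : B) (χ : AddChar B ℂ) (t : A) (q q' : Fin d) (u u' : A) (v v' : B) :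
    ∑ o, star (senderKraus V p ((j, χ), t) o (q, (u, v))) *
        senderKraus V p ((j, χ), t) o (q', (u', v'))
      = if u = t ∧ u' = t then star (bellNorm B) * bellNorm B * χ (v - v') *
          ∑ a, ∑ e, star (V a (v - j) e q) * V a (v' - j) e q' else 0 := by
  rw [sum_registers (j, χ)]
  · by_cases hu : u = t ∧ u' = t
    · obtain ⟨rfl, rfl⟩ := hu
      rw [if_pos ⟨rfl, rfl⟩, Fintype.sum_prod_type]
      have h1 : ∀ a₀ e a₁, star (senderKraus V p ((j, χ), u') (((a₀, e), (j, χ)), (a₁, (j, χ)))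
          (q, (u', v))) * senderKraus V p ((j, χ), u') (((a₀, e), (j, χ)), (a₁, (j, χ)))
          (q', (u', v')) = if p (a₀ + a₁) = a₁ then star (bellNorm B) * bellNorm B * χ (v - v') *
            (star (V (a₀ + a₁) (v - j) e q) * V (a₀ + a₁) (v' - j) e q') else 0 := by
        intro a₀ e a₁
        by_cases hp : p (a₀ + a₁) = a₁
        · simp only [senderKraus, Matrix.of_apply, hp, and_self, if_true, star_mul']
          rw [← sub_sub_sub_cancel_left v' v j, ← addChar_star_mul χ (j - v) (j - v')]
          ring
        · simp [senderKraus, hp, -map_add]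
      simp only [h1]
      have h2 : ∀ a₀, ∑ e, ∑ a₁, (if p (a₀ + a₁) = a₁ then star (bellNorm B) * bellNorm B *
          χ (v - v') * (star (V (a₀ + a₁) (v - j) e q) * V (a₀ + a₁) (v' - j) e q') else 0) =
          ∑ a₁, if p (a₀ + a₁) = a₁ then ∑ e, star (bellNorm B) * bellNorm B *
          χ (v - v') * (star (V (a₀ + a₁) (v - j) e q) * V (a₀ + a₁) (v' - j) e q') else 0 := by
        intro a₀
        rw [Finset.sum_comm]
        refine Finset.sum_congr rfl fun a₁ _ => ?_
        split_ifs <;> simp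
      simp only [h2]
      rw [sum_sum_ite_map_add p fun a => ∑ e, star (bellNorm B) * bellNorm B *
          χ (v - v') * (star (V a (v - j) e q) * V a (v' - j) e q')]
      simp only [Finset.mul_sum]
    · rw [if_neg hu]
      refine Finset.sum_eq_zero fun w _ => Finset.sum_eq_zero fun a₁ _ => ?_
      rw [not_and_or] at hu
      rcases hu with hu | hu <;> simp [senderKraus, hu]
  · intro o ho
    have : senderKraus V p ((j, χ), t) o (q, (u, v)) = 0 := if_neg fun h => ho ⟨h.1, h.2.1⟩
    rw [this]
    simp

variable [DecidableEq B]

/-- The first operation on the left. -/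
def senderChannel (V : A → B → κ → Fin d → ℂ) (hV : IsIsometry V) (p : A →+ A) :
    Channel (Fin d × (A × B)) (((A × κ) × BellLabel B) × (A × BellLabel B)) where
  κ := BellLabel B × A
  kraus := senderKraus V p
  tracePreserving := by
    ext ⟨q, u, v⟩ ⟨q', u', v'⟩
    rw [Matrix.sum_apply]
    simp only [Matrix.mul_apply, conjTranspose_apply]
    rw [Fintype.sum_prod_type, Fintype.sum_prod_type]
    simp only [sum_star_senderKraus_mul]
    -- Character orthogonality forces `v = v'`, and the basis measurement of the `A`-part forces `u
    -- = u'`. The sum over `j` then runs over all of `B`.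
    have h1 : ∀ j, ∑ χ : AddChar B ℂ, ∑ t, (if u = t ∧ u' = t then star (bellNorm B) *
        bellNorm B * χ (v - v') * ∑ a, ∑ e, star (V a (v - j) e q) * V a (v' - j) e q' else 0) =
        if u = u' ∧ v = v' then ∑ a, ∑ e, star (V a (v - j) e q) * V a (v - j) e q' else 0 := by
      intro j
      by_cases hu : u = u'
      · subst hu
        simp only [and_self, Finset.sum_ite_eq, Finset.mem_univ, if_true, true_and]
        rw [← Finset.sum_mul, ← Finset.mul_sum, AddChar.sum_apply_eq_ite]
        by_cases hv : v = v'
        · subst hv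
          rw [if_pos (sub_self v), star_bellNorm_mul, one_mul, if_pos rfl]
        · rw [if_neg (sub_ne_zero.2 hv), if_neg hv]
          simp
      · rw [if_neg fun h => hu h.1]
        refine Finset.sum_eq_zero fun χ _ => Finset.sum_eq_zero fun t _ => if_neg ?_
        rintro ⟨h, h'⟩
        exact hu (h.trans h'.symm)
    simp only [h1]
    by_cases h : u = u' ∧ v = v'
    · obtain ⟨rfl, rfl⟩ := h
      simp only [and_self, if_true]
      have h2 := Equiv.sum_comp (Equiv.subLeft v)
        fun b => ∑ a, ∑ e, star (V a b e q) * V a b e q'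
      simp only [Equiv.subLeft_apply] at h2
      rw [h2, Finset.sum_comm, hV q q']
      simp [Matrix.one_apply]
    · rw [Finset.sum_eq_zero fun _ _ => if_neg h, Matrix.one_apply, if_neg]
      rintro h'
      simp only [Prod.mk.injEq] at h'
      exact h h'.2

/-- The Kraus operator of the receiver, the `A`-part of the resource being found in the basis
state `t`: split the `B`-part of the resource according to `p`. -/
def receiverKraus (p : B →+ B) (t : A) : Matrix (B × B) (A × B) ℂ :=
  Matrix.of fun o i => if i.1 = t ∧ i.2 = o.1 + o.2 ∧ p (o.1 + o.2) = o.2 then 1 else 0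

/-- The first operation on the right. -/
def receiverChannel (A : Type) [Fintype A] [DecidableEq A] (p : B →+ B) :
    Channel (A × B) (B × B) where
  κ := A
  kraus := receiverKraus p
  tracePreserving := by
    ext ⟨u, v⟩ ⟨u', v'⟩
    rw [Matrix.sum_apply]
    simp only [Matrix.mul_apply, conjTranspose_apply, Fintype.sum_prod_type]
    have h1 : ∀ t b₀ b₁, star (receiverKraus p t (b₀, b₁) (u, v)) *
        receiverKraus p t (b₀, b₁) (u', v') = if p (b₀ + b₁) = b₁ then
          (if u = t ∧ u' = t then if v = b₀ + b₁ ∧ v' = b₀ + b₁ then 1 else 0 else 0) else 0 := by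
      intro t b₀ b₁
      simp only [receiverKraus, Matrix.of_apply]
      split_ifs <;> simp_all
    simp only [h1]
    have h2 : ∀ t, ∑ b₀, ∑ b₁, (if p (b₀ + b₁) = b₁ then (if u = t ∧ u' = t then
        if v = b₀ + b₁ ∧ v' = b₀ + b₁ then (1 : ℂ) else 0 else 0) else 0) =
        ∑ b, if u = t ∧ u' = t then if v = b ∧ v' = b then 1 else 0 else 0 := fun t =>
      sum_sum_ite_map_add p fun b => if u = t ∧ u' = t then if v = b ∧ v' = b then 1 else 0 else 0
    simp only [h2, Matrix.one_apply, Prod.mk.injEq]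
    by_cases hu : u = u'
    · subst hu
      by_cases hv : v = v'
      · subst hv
        simp
      · have : ∀ b, ¬(v = b ∧ v' = b) := fun b h => hv (h.1.trans h.2.symm)
        simp [this, hv]
    · have : ∀ t, ¬(u = t ∧ u' = t) := fun b h => hu (h.1.trans h.2.symm)
      simp [this, hu]

/-- The protocol that applies an isometry `V` on the left, teleports its `B`-part to the right
without correction, and exchanges parts of the `A`-part and of the teleported `B`-part. -/
def teleportProtocol [DecidableEq κ] (V : A → B → κ → Fin d → ℂ) (hV : IsIsometry V)
    (pA : (Fin n → Bool) → A →+ A) (pB : (Fin n → Bool) → B →+ B)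
    (second₀ : (x y : Fin n → Bool) → Channel (((A × κ) × BellLabel B) × B) (Fin d))
    (second₁ : (x y : Fin n → Bool) → Channel ((A × BellLabel B) × B) (Fin d)) :
    RoutingProtocol n d where
  L := A × B
  K₀ := (A × κ) × BellLabel B
  M₀ := A × BellLabel B
  M₁ := B
  K₁ := B
  first₀ x := senderChannel V hV (pA x)
  first₁ y := receiverChannel A (pB y)
  second₀ := second₀
  second₁ := second₁

end Teleport

/-! ### Knill–Laflamme conditions after teleportation -/

section Teleport

variable {n d : ℕ} {A B κ : Type} [AddCommGroup A] [Fintype A] [DecidableEq A]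
  [AddCommGroup B] [Fintype B] [DecidableEq B] [Fintype κ] [DecidableEq κ]

/-- The resource forces equal `A`-outcomes and `b₀ + b₁ = b + m.1`, with `b` the `B`-label produced
by `V`: teleportation shifts by `m.1` and adds a phase. -/
theorem teleportProtocol_roundOp_apply (V : A → B → κ → Fin d → ℂ) (hV : IsIsometry V)
    (pA : (Fin n → Bool) → A →+ A) (pB : (Fin n → Bool) → B →+ B)
    (s₀ : (x y : Fin n → Bool) → Channel (((A × κ) × BellLabel B) × B) (Fin d))
    (s₁ : (x y : Fin n → Bool) → Channel ((A × BellLabel B) × B) (Fin d))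
    (x y : Fin n → Bool) (m m₁ m₂ : BellLabel B) (t t' : A) (a₀ a₁ : A) (b₀ b₁ : B) (e : κ)
    (q : Fin d) :
    (teleportProtocol V hV pA pB s₀ s₁).roundOp x y ((m, t), t')
        ((((a₀, e), m₁), b₀), ((a₁, m₂), b₁)) q
      = if (m₁ = m ∧ m₂ = m ∧ t = t') ∧ pA x (a₀ + a₁) = a₁ ∧ pB y (b₀ + b₁) = b₁ then
          bellNorm B * m.2 (m.1 - (b₀ + b₁)) * V (a₀ + a₁) (b₀ + b₁ - m.1) e q else 0 := by
  change ∑ l : A × B, senderKraus V (pA x) (m, t) (((a₀, e), m₁), (a₁, m₂)) (q, l) *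
    receiverKraus (pB y) t' (b₀, b₁) l = _
  rw [Finset.sum_eq_single (t, b₀ + b₁)]
  · by_cases h : (m₁ = m ∧ m₂ = m ∧ t = t') ∧ pA x (a₀ + a₁) = a₁ ∧ pB y (b₀ + b₁) = b₁
    · rw [if_pos h]
      obtain ⟨⟨rfl, rfl, rfl⟩, h1, h2⟩ := h
      simp [senderKraus, receiverKraus, h1, h2, -map_add]
    · rw [if_neg h]
      simp only [senderKraus, receiverKraus, Matrix.of_apply]
      split_ifs <;> simp_all
  · rintro ⟨u, v⟩ - hl
    simp only [senderKraus, receiverKraus, Matrix.of_apply]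
    split_ifs <;> simp_all
  · simp

theorem map_add_eq_right_iff {A : Type} [AddCommGroup A] (p : A →+ A)
    (hp : ∀ a, p (p a) = p a) (a₀ a₁ : A) :
    p (a₀ + a₁) = a₁ ↔ p a₀ = 0 ∧ p a₁ = a₁ := by
  constructor
  · intro h
    have h1 : p a₁ = a₁ := by rw [← h, hp]
    refine ⟨?_, h1⟩
    rw [map_add, h1] at h
    simpa using h
  · rintro ⟨h0, h1⟩
    rw [map_add, h0, h1, zero_add]

/-- The Knill–Laflamme condition for recovering from the parts fixed by `pA` and `pB`. -/
def RightCorrectable (V : A → B → κ → Fin d → ℂ) (pA : A →+ A) (pB : B →+ B) : Prop :=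
  ∀ a₀ a₀' b₀ b₀' e e', pA a₀ = 0 → pA a₀' = 0 → pB b₀ = 0 → pB b₀' = 0 → ∃ s : ℂ, ∀ q q',
    ∑ a₁, ∑ b₁, (if pA a₁ = a₁ ∧ pB b₁ = b₁ then
      star (V (a₀ + a₁) (b₀ + b₁) e q) * V (a₀' + a₁) (b₀' + b₁) e' q' else 0)
      = if q = q' then s else 0

/-- The Knill–Laflamme condition for recovering from the parts killed by `pA` and `pB`. -/
def LeftCorrectable (V : A → B → κ → Fin d → ℂ) (pA : A →+ A) (pB : B →+ B) : Prop :=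
  ∀ a₁ a₁' b₁ b₁', pA a₁ = a₁ → pA a₁' = a₁' → pB b₁ = b₁ → pB b₁' = b₁' → ∃ s : ℂ, ∀ q q',
    ∑ a₀, ∑ b₀, ∑ e, (if pA a₀ = 0 ∧ pB b₀ = 0 then
      star (V (a₀ + a₁) (b₀ + b₁) e q) * V (a₀ + a₁') (b₀ + b₁') e q' else 0)
      = if q = q' then s else 0

variable (V : A → B → κ → Fin d → ℂ) (hV : IsIsometry V)
    (pA : (Fin n → Bool) → A →+ A) (pB : (Fin n → Bool) → B →+ B)
    (s₀ : (x y : Fin n → Bool) → Channel (((A × κ) × BellLabel B) × B) (Fin d))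
    (s₁ : (x y : Fin n → Bool) → Channel ((A × BellLabel B) × B) (Fin d))
    (x y : Fin n → Bool)

theorem teleportProtocol_rightOp (hA : ∀ a, pA x (pA x a) = pA x a)
    (hB : ∀ b, pB y (pB y b) = pB y b) (h : RightCorrectable V (pA x) (pB y))
    (t t' : ((BellLabel B × A) × A) × (((A × κ) × BellLabel B) × B)) :
    ∃ s : ℂ, ((teleportProtocol V hV pA pB s₀ s₁).rightOp x y t)ᴴ *
      (teleportProtocol V hV pA pB s₀ s₁).rightOp x y t'
        = s • (1 : Matrix (Fin d) (Fin d) ℂ) := by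
  obtain ⟨⟨⟨m, u⟩, u'⟩, ⟨⟨a₀, e⟩, m₁⟩, b₀⟩ := t
  obtain ⟨⟨⟨m', v⟩, v'⟩, ⟨⟨a₀', e'⟩, m₁'⟩, b₀'⟩ := t'
  have hentry : ∀ q q', (((teleportProtocol V hV pA pB s₀ s₁).rightOp x y
        (((m, u), u'), (((a₀, e), m₁), b₀)))ᴴ * (teleportProtocol V hV pA pB s₀ s₁).rightOp x y
        (((m', v), v'), (((a₀', e'), m₁'), b₀'))) q q' =
      ∑ a₁, ∑ m₂, ∑ b₁,
        star (if (m₁ = m ∧ m₂ = m ∧ u = u') ∧ (pA x a₀ = 0 ∧ pA x a₁ = a₁) ∧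
          (pB y b₀ = 0 ∧ pB y b₁ = b₁) then bellNorm B * m.2 (m.1 - (b₀ + b₁)) *
            V (a₀ + a₁) (b₀ + b₁ - m.1) e q else 0) *
        (if (m₁' = m' ∧ m₂ = m' ∧ v = v') ∧ (pA x a₀' = 0 ∧ pA x a₁ = a₁) ∧
          (pB y b₀' = 0 ∧ pB y b₁ = b₁) then bellNorm B * m'.2 (m'.1 - (b₀' + b₁)) *
            V (a₀' + a₁) (b₀' + b₁ - m'.1) e' q' else 0) := by
    intro q q'
    rw [Matrix.mul_apply]
    simp only [← map_add_eq_right_iff _ hA, ← map_add_eq_right_iff _ hB,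
      ← teleportProtocol_roundOp_apply V hV pA pB s₀ s₁]
    change ∑ r : (A × BellLabel B) × B, _ = _
    rw [Fintype.sum_prod_type, Fintype.sum_prod_type]
    rfl
  -- Otherwise one operator vanishes or the outcome registers differ, so every product is zero and
  -- `s = 0`.
  by_cases hc : (m₁ = m ∧ m₁' = m' ∧ m = m' ∧ u = u' ∧ v = v') ∧
      pA x a₀ = 0 ∧ pA x a₀' = 0 ∧ pB y b₀ = 0 ∧ pB y b₀' = 0
  · obtain ⟨⟨rfl, rfl, rfl, rfl, rfl⟩, ha, ha', hb, hb'⟩ := hc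
    obtain ⟨j, χ⟩ := m₁
    -- The shift `j` splits: `j - pB y j` moves the labels on the left, while `pB y j` is absorbed
    -- by translating the summation over the right part.
    have hk : ∀ b, pB y (b - (j - pB y j)) = pB y b := by
      intro b
      rw [map_sub, map_sub, hB, sub_self, sub_zero]
    obtain ⟨s, hs⟩ := h a₀ a₀' (b₀ - (j - pB y j)) (b₀' - (j - pB y j)) e e' ha ha'
      ((hk _).trans hb) ((hk _).trans hb')
    -- The phases combine to `χ (b₀ - b₀')`, independent of the summed `b₁`, and so leave the sum.
    refine ⟨star (bellNorm B) * bellNorm B * χ (b₀ - b₀') * s, ?_⟩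
    ext q q'
    refine (hentry q q').trans ?_
    rw [Matrix.smul_apply, Matrix.one_apply, smul_eq_mul, mul_ite, mul_one, mul_zero,
      ← mul_zero (star (bellNorm B) * bellNorm B * χ (b₀ - b₀')), ← mul_ite, ← hs,
      Finset.mul_sum]
    refine Finset.sum_congr rfl fun a₁ _ => ?_
    rw [Finset.sum_eq_single (j, χ) _ (by simp)]
    · rw [← Equiv.sum_comp (Equiv.addRight (pB y j)), Finset.mul_sum]
      refine Finset.sum_congr rfl fun b₁ _ => ?_
      have hfix : pB y (b₁ + pB y j) = b₁ + pB y j ↔ pB y b₁ = b₁ := by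
        rw [map_add, hB, add_left_inj]
      have h1 : b₀ + (b₁ + pB y j) - j = b₀ - (j - pB y j) + b₁ := by abel
      have h2 : b₀' + (b₁ + pB y j) - j = b₀' - (j - pB y j) + b₁ := by abel
      have h3 : j - (b₀' + (b₁ + pB y j)) - (j - (b₀ + (b₁ + pB y j))) = b₀ - b₀' := by abel
      simp only [Equiv.coe_addRight, hfix, ha, ha', hb, hb', true_and, and_self, h1, h2]
      by_cases hab : pA x a₁ = a₁ ∧ pB y b₁ = b₁
      · rw [if_pos hab, if_pos hab, if_pos hab, star_mul', star_mul', ← h3,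
          ← addChar_star_mul χ (j - (b₀ + (b₁ + pB y j))) (j - (b₀' + (b₁ + pB y j)))]
        ring
      · rw [if_neg hab, if_neg hab, if_neg hab]
        simp
    · intro m₂ _ hm
      simp [hm]
  · refine ⟨0, ?_⟩
    ext q q'
    refine (hentry q q').trans ?_
    rw [zero_smul, Matrix.zero_apply]
    refine Finset.sum_eq_zero fun a₁ _ => Finset.sum_eq_zero fun m₂ _ =>
      Finset.sum_eq_zero fun b₁ _ => ?_
    split_ifs with h1 h2
    · exact absurd ⟨⟨h1.1.1, h2.1.1, h1.1.2.1.symm.trans h2.1.2.1, h1.1.2.2, h2.1.2.2⟩,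
        h1.2.1.1, h2.2.1.1, h1.2.2.1, h2.2.2.1⟩ hc
    all_goals simp

theorem teleportProtocol_leftOp (hA : ∀ a, pA x (pA x a) = pA x a)
    (hB : ∀ b, pB y (pB y b) = pB y b) (h : LeftCorrectable V (pA x) (pB y))
    (t t' : ((BellLabel B × A) × A) × ((A × BellLabel B) × B)) :
    ∃ s : ℂ, ((teleportProtocol V hV pA pB s₀ s₁).leftOp x y t)ᴴ *
      (teleportProtocol V hV pA pB s₀ s₁).leftOp x y t'
        = s • (1 : Matrix (Fin d) (Fin d) ℂ) := by
  obtain ⟨⟨⟨m, u⟩, u'⟩, ⟨a₁, m₂⟩, b₁⟩ := t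
  obtain ⟨⟨⟨m', v⟩, v'⟩, ⟨a₁', m₂'⟩, b₁'⟩ := t'
  have hentry : ∀ q q', (((teleportProtocol V hV pA pB s₀ s₁).leftOp x y
        (((m, u), u'), ((a₁, m₂), b₁)))ᴴ * (teleportProtocol V hV pA pB s₀ s₁).leftOp x y
        (((m', v), v'), ((a₁', m₂'), b₁'))) q q' =
      ∑ m₁, ∑ b₀, ∑ a₀, ∑ e,
        star (if (m₁ = m ∧ m₂ = m ∧ u = u') ∧ (pA x a₀ = 0 ∧ pA x a₁ = a₁) ∧
          (pB y b₀ = 0 ∧ pB y b₁ = b₁) then bellNorm B * m.2 (m.1 - (b₀ + b₁)) *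
            V (a₀ + a₁) (b₀ + b₁ - m.1) e q else 0) *
        (if (m₁ = m' ∧ m₂' = m' ∧ v = v') ∧ (pA x a₀ = 0 ∧ pA x a₁' = a₁') ∧
          (pB y b₀ = 0 ∧ pB y b₁' = b₁') then bellNorm B * m'.2 (m'.1 - (b₀ + b₁')) *
            V (a₀ + a₁') (b₀ + b₁' - m'.1) e q' else 0) := by
    intro q q'
    rw [Matrix.mul_apply]
    simp only [← map_add_eq_right_iff _ hA, ← map_add_eq_right_iff _ hB,
      ← teleportProtocol_roundOp_apply V hV pA pB s₀ s₁]
    change ∑ r : ((A × κ) × BellLabel B) × B, _ = _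
    rw [Fintype.sum_prod_type, Fintype.sum_prod_type, Fintype.sum_prod_type]
    rw [Finset.sum_congr rfl fun a₀ _ => Finset.sum_comm, Finset.sum_comm]
    refine Finset.sum_congr rfl fun m₁ _ => ?_
    rw [Finset.sum_congr rfl fun a₀ _ => Finset.sum_comm, Finset.sum_comm]
    rfl
  by_cases hc : (m₂ = m ∧ m₂' = m' ∧ m = m' ∧ u = u' ∧ v = v') ∧
      pA x a₁ = a₁ ∧ pA x a₁' = a₁' ∧ pB y b₁ = b₁ ∧ pB y b₁' = b₁'
  · obtain ⟨⟨rfl, rfl, rfl, rfl, rfl⟩, ha, ha', hb, hb'⟩ := hc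
    obtain ⟨j, χ⟩ := m₂
    -- Roles reversed: `pB y j` now shifts the fixed labels on the right, and `j - pB y j`
    -- translates the summation over the left part.
    have hk : ∀ b, pB y b = b → pB y (b - pB y j) = b - pB y j := by
      intro b hb
      rw [map_sub, hB, hb]
    obtain ⟨s, hs⟩ := h a₁ a₁' (b₁ - pB y j) (b₁' - pB y j) ha ha' (hk _ hb) (hk _ hb')
    refine ⟨star (bellNorm B) * bellNorm B * χ (b₁ - b₁') * s, ?_⟩
    ext q q'
    refine (hentry q q').trans ?_
    rw [Matrix.smul_apply, Matrix.one_apply, smul_eq_mul, mul_ite, mul_one, mul_zero,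
      ← mul_zero (star (bellNorm B) * bellNorm B * χ (b₁ - b₁')), ← mul_ite, ← hs,
      Finset.sum_comm (s := (Finset.univ : Finset A)), Finset.mul_sum]
    rw [Finset.sum_eq_single (j, χ) _ (by simp)]
    · rw [← Equiv.sum_comp (Equiv.addRight (j - pB y j))]
      refine Finset.sum_congr rfl fun b₀ _ => ?_
      rw [Finset.mul_sum]
      refine Finset.sum_congr rfl fun a₀ _ => ?_
      rw [Finset.mul_sum]
      refine Finset.sum_congr rfl fun e _ => ?_
      have hfix : pB y (b₀ + (j - pB y j)) = 0 ↔ pB y b₀ = 0 := by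
        rw [map_add, map_sub, hB, sub_self, add_zero]
      have h1 : b₀ + (j - pB y j) + b₁ - j = b₀ + (b₁ - pB y j) := by abel
      have h2 : b₀ + (j - pB y j) + b₁' - j = b₀ + (b₁' - pB y j) := by abel
      have h3 : j - (b₀ + (j - pB y j) + b₁') - (j - (b₀ + (j - pB y j) + b₁)) = b₁ - b₁' := by
        abel
      simp only [Equiv.coe_addRight, hfix, ha, ha', hb, hb', true_and, and_true, and_self, h1, h2]
      by_cases hab : pA x a₀ = 0 ∧ pB y b₀ = 0
      · rw [if_pos hab, if_pos hab, if_pos hab, star_mul', star_mul', ← h3,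
          ← addChar_star_mul χ (j - (b₀ + (j - pB y j) + b₁)) (j - (b₀ + (j - pB y j) + b₁'))]
        ring
      · rw [if_neg hab, if_neg hab, if_neg hab]
        simp
    · intro m₁ _ hm
      simp [hm]
  · refine ⟨0, ?_⟩
    ext q q'
    refine (hentry q q').trans ?_
    rw [zero_smul, Matrix.zero_apply]
    refine Finset.sum_eq_zero fun m₁ _ => Finset.sum_eq_zero fun b₀ _ =>
      Finset.sum_eq_zero fun a₀ _ => Finset.sum_eq_zero fun e _ => ?_
    split_ifs with h1 h2
    · exact absurd ⟨⟨h1.1.2.1, h2.1.2.1, h1.1.1.symm.trans h2.1.1, h1.1.2.2, h2.1.2.2⟩,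
        h1.2.1.2, h2.2.1.2, h1.2.2.2, h2.2.2.2⟩ hc
    all_goals simp

/-- Teleportation reduces the routing task to the Knill–Laflamme conditions. -/
theorem exists_completes_of_correctable (hd : 0 < d) (hV : IsIsometry V)
    (f : (Fin n ⊕ Fin n → Bool) → Bool)
    (hA : ∀ x a, pA x (pA x a) = pA x a) (hB : ∀ y b, pB y (pB y b) = pB y b)
    (h₁ : ∀ x y, f (Sum.elim x y) = true → RightCorrectable V (pA x) (pB y))
    (h₀ : ∀ x y, f (Sum.elim x y) = false → LeftCorrectable V (pA x) (pB y)) :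
    ∃ P : RoutingProtocol n d, P.Completes f ∧
      Fintype.card P.L = Fintype.card A * Fintype.card B := by
  have : Nonempty (Fin d) := ⟨⟨0, hd⟩⟩
  obtain ⟨c₀⟩ := nonempty_channel (((A × κ) × BellLabel B) × B) (Fin d)
  obtain ⟨c₁⟩ := nonempty_channel ((A × BellLabel B) × B) (Fin d)
  rw [← Fintype.card_prod]
  exact (teleportProtocol V hV pA pB (fun _ _ => c₀) (fun _ _ => c₁)).exists_completes hd f
    (fun x y hf => teleportProtocol_rightOp V hV pA pB _ _ x y (hA x) (hB y) (h₁ x y hf))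
    (fun x y hf => teleportProtocol_leftOp V hV pA pB _ _ x y (hA x) (hB y) (h₀ x y hf))

end Teleport

/-! ### Restriction to a set of shares -/

/-- The projection of a product of groups onto the factors with `z i = 1`. -/
def restrictHom {ι : Type} {G : ι → Type} [∀ i, AddCommGroup (G i)] (z : ι → Bool) :
    ((i : ι) → G i) →+ ((i : ι) → G i) where
  toFun a i := if z i = true then a i else 0
  map_zero' := by
    ext i
    simp
  map_add' a b := by
    ext i
    by_cases h : z i = true <;> simp [h]

theorem restrictHom_apply {ι : Type} {G : ι → Type} [∀ i, AddCommGroup (G i)] (z : ι → Bool)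
    (a : (i : ι) → G i) (i : ι) : restrictHom z a i = if z i = true then a i else 0 := rfl

theorem restrictHom_restrictHom {ι : Type} {G : ι → Type} [∀ i, AddCommGroup (G i)]
    (z : ι → Bool) (a : (i : ι) → G i) : restrictHom z (restrictHom z a) = restrictHom z a := by
  ext i
  by_cases h : z i = true <;> simp [restrictHom_apply, h]

theorem restrictHom_eq_self_iff {ι : Type} {G : ι → Type} [∀ i, AddCommGroup (G i)]
    {z : ι → Bool} {a : (i : ι) → G i} :
    restrictHom z a = a ↔ ∀ i, ¬z i = true → a i = 0 := by
  rw [funext_iff]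
  refine forall_congr' fun i => ?_
  by_cases h : z i = true <;> simp [restrictHom_apply, h, eq_comm]

theorem restrictHom_eq_zero_iff {ι : Type} {G : ι → Type} [∀ i, AddCommGroup (G i)]
    {z : ι → Bool} {a : (i : ι) → G i} :
    restrictHom z a = 0 ↔ ∀ i, z i = true → a i = 0 := by
  rw [funext_iff]
  refine forall_congr' fun i => ?_
  by_cases h : z i = true <;> simp [restrictHom_apply, h]

/-! ### The scheme's isometry satisfies the conditions -/

namespace SharingScheme

/-- With an empty share there are no Kraus entries, so trace preservation would read `0 = 1`. -/
theorem dim_ne_zero {ι : Type} [Fintype ι] [DecidableEq ι] {d : ℕ} (hd : 0 < d)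
    (S : SharingScheme ι d) (i : ι) : S.dim i ≠ 0 := by
  intro h
  have : IsEmpty ((i : ι) → Fin (S.dim i)) := ⟨fun s => (h ▸ s i : Fin 0).elim0⟩
  simpa using S.encode.sum_star_kraus_mul ⟨0, hd⟩ ⟨0, hd⟩

variable {n d : ℕ} (S : SharingScheme (Fin n ⊕ Fin n) d)

/-- The basis of the joint system of the shares indexed by the first half. -/
abbrev LeftBasis : Type := (i : Fin n) → Fin (S.dim (Sum.inl i))

/-- The basis of the joint system of the shares indexed by the second half. -/
abbrev RightBasis : Type := (i : Fin n) → Fin (S.dim (Sum.inr i))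

/-- The basis vector of all shares with given halves. -/
abbrev joint (a : S.LeftBasis) (b : S.RightBasis) : (i : Fin n ⊕ Fin n) → Fin (S.dim i) :=
  (Equiv.sumPiEquivProdPi fun i => Fin (S.dim i)).symm (a, b)

/-- The matrix entries of the Stinespring isometry of the encoding. -/
def isometry (a : S.LeftBasis) (b : S.RightBasis) (e : S.encode.κ) (q : Fin d) : ℂ :=
  S.encode.kraus e (S.joint a b) q

theorem sum_sum_joint (F : ((i : Fin n ⊕ Fin n) → Fin (S.dim i)) → ℂ) :
    ∑ a, ∑ b, F (S.joint a b) = ∑ s, F s := by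
  rw [← Equiv.sum_comp (Equiv.sumPiEquivProdPi fun i => Fin (S.dim i)).symm,
    Fintype.sum_prod_type]

theorem sum_sum_glue (z : Fin n ⊕ Fin n → Bool)
    (F : ((i : Fin n ⊕ Fin n) → Fin (S.dim i)) → ℂ) :
    ∑ r, ∑ l, F (S.glue z r l) = ∑ s, F s := by
  rw [← Equiv.sum_comp (Equiv.piEquivPiSubtypeProd (fun i => z i = true)
    (fun i => Fin (S.dim i))).symm, Fintype.sum_prod_type]

theorem isIsometry_isometry : IsIsometry S.isometry := by
  intro q q'
  simp only [isometry]
  rw [S.sum_sum_joint fun s => ∑ e, star (S.encode.kraus e s q) * S.encode.kraus e s q',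
    Finset.sum_comm]
  exact S.encode.sum_star_kraus_mul q q'

theorem joint_add (a a' : S.LeftBasis) (b b' : S.RightBasis) :
    S.joint (a + a') (b + b') = S.joint a b + S.joint a' b' := by
  ext (i | i) <;> rfl

variable [∀ i, NeZero (S.dim i)]

theorem restrictHom_joint (x y : Fin n → Bool) (a : S.LeftBasis) (b : S.RightBasis) :
    restrictHom (Sum.elim x y) (S.joint a b) = S.joint (restrictHom x a) (restrictHom y b) := by
  ext (i | i) <;> rfl

theorem restrictHom_joint_eq_self_iff (x y : Fin n → Bool) (a : S.LeftBasis)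
    (b : S.RightBasis) : restrictHom (Sum.elim x y) (S.joint a b) = S.joint a b ↔
      restrictHom x a = a ∧ restrictHom y b = b := by
  rw [restrictHom_joint, joint, joint, EmbeddingLike.apply_eq_iff_eq, Prod.mk.injEq]

theorem restrictHom_joint_eq_zero_iff (x y : Fin n → Bool) (a : S.LeftBasis)
    (b : S.RightBasis) : restrictHom (Sum.elim x y) (S.joint a b) = 0 ↔
      restrictHom x a = 0 ∧ restrictHom y b = 0 := by
  have h0 : (0 : (i : Fin n ⊕ Fin n) → Fin (S.dim i)) = S.joint 0 0 := by
    ext (i | i) <;> rfl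
  rw [restrictHom_joint, h0, joint, joint, EmbeddingLike.apply_eq_iff_eq, Prod.mk.injEq]

/-- Labels fixed by the restriction are those extended by `0` from the shares in `z`; this turns
conditions stated by projections into sums over shares. -/
theorem sum_ite_restrictHom_eq_self (z : Fin n ⊕ Fin n → Bool)
    (F : ((i : Fin n ⊕ Fin n) → Fin (S.dim i)) → ℂ) :
    ∑ s, (if restrictHom z s = s then F s else 0) = ∑ r, F (S.glue z r 0) := by
  rw [← S.sum_sum_glue z]
  refine Finset.sum_congr rfl fun r _ => ?_
  rw [Finset.sum_eq_single 0]
  · rw [if_pos]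
    rw [restrictHom_eq_self_iff]
    intro i hi
    simp [hi]
  · intro l _ hl
    rw [if_neg]
    rw [restrictHom_eq_self_iff]
    intro h
    refine hl (funext fun i => ?_)
    simpa [i.2] using h i i.2
  · simp

theorem sum_ite_restrictHom_eq_zero (z : Fin n ⊕ Fin n → Bool)
    (F : ((i : Fin n ⊕ Fin n) → Fin (S.dim i)) → ℂ) :
    ∑ s, (if restrictHom z s = 0 then F s else 0) = ∑ l, F (S.glue z 0 l) := by
  rw [← S.sum_sum_glue z, Finset.sum_comm]
  refine Finset.sum_congr rfl fun l _ => ?_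
  rw [Finset.sum_eq_single 0]
  · rw [if_pos]
    rw [restrictHom_eq_zero_iff]
    intro i hi
    simp [hi]
  · intro r _ hr
    rw [if_neg]
    rw [restrictHom_eq_zero_iff]
    intro h
    refine hr (funext fun i => ?_)
    simpa [i.2] using h i i.2
  · simp

theorem add_glue_zero (z : Fin n ⊕ Fin n → Bool) (s : (i : Fin n ⊕ Fin n) → Fin (S.dim i))
    (hs : restrictHom z s = 0) (r : S.Shares z) :
    s + S.glue z r 0 = S.glue z r fun i => s i := by
  rw [restrictHom_eq_zero_iff] at hs
  ext i
  by_cases h : z i = true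
  · simp [h, hs i h]
  · simp [h]

theorem glue_zero_add (z : Fin n ⊕ Fin n → Bool) (s : (i : Fin n ⊕ Fin n) → Fin (S.dim i))
    (hs : restrictHom z s = s) (l : S.OtherShares z) :
    S.glue z 0 l + s = S.glue z (fun i => s i) l := by
  rw [restrictHom_eq_self_iff] at hs
  ext i
  by_cases h : z i = true
  · simp [h]
  · simp [h, hs i h]

theorem rightCorrectable {x y : Fin n → Bool} (h : S.Authorized (Sum.elim x y)) :
    RightCorrectable S.isometry (restrictHom x) (restrictHom y) := by
  intro a₀ a₀' b₀ b₀' e e' ha ha' hb hb'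
  have hs := (S.restrictHom_joint_eq_zero_iff x y a₀ b₀).2 ⟨ha, hb⟩
  have hs' := (S.restrictHom_joint_eq_zero_iff x y a₀' b₀').2 ⟨ha', hb'⟩
  obtain ⟨c, hc⟩ := h.exists_sum_eq (fun i => S.joint a₀ b₀ i) (fun i => S.joint a₀' b₀' i) e e'
  refine ⟨c, fun q q' => ?_⟩
  rw [← hc]
  simp only [isometry, joint_add, ← restrictHom_joint_eq_self_iff]
  rw [S.sum_sum_joint fun s => if restrictHom (Sum.elim x y) s = s then
    star (S.encode.kraus e (S.joint a₀ b₀ + s) q) *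
      S.encode.kraus e' (S.joint a₀' b₀' + s) q' else 0,
    S.sum_ite_restrictHom_eq_self]
  simp only [add_glue_zero _ _ _ hs, add_glue_zero _ _ _ hs']

theorem leftCorrectable {x y : Fin n → Bool} (h : S.Unauthorized (Sum.elim x y)) :
    LeftCorrectable S.isometry (restrictHom x) (restrictHom y) := by
  intro a₁ a₁' b₁ b₁' ha ha' hb hb'
  have hs := (S.restrictHom_joint_eq_self_iff x y a₁ b₁).2 ⟨ha, hb⟩
  have hs' := (S.restrictHom_joint_eq_self_iff x y a₁' b₁').2 ⟨ha', hb'⟩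
  obtain ⟨c, hc⟩ := h.exists_sum_eq (fun i => S.joint a₁ b₁ i) (fun i => S.joint a₁' b₁' i)
  refine ⟨c, fun q q' => ?_⟩
  rw [← hc]
  simp only [isometry, joint_add, ← restrictHom_joint_eq_zero_iff]
  rw [S.sum_sum_joint fun s => ∑ e, if restrictHom (Sum.elim x y) s = 0 then
    star (S.encode.kraus e (s + S.joint a₁ b₁) q) *
      S.encode.kraus e (s + S.joint a₁' b₁') q' else 0]
  have h1 : ∀ s, (∑ e, if restrictHom (Sum.elim x y) s = 0 then
      star (S.encode.kraus e (s + S.joint a₁ b₁) q) *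
        S.encode.kraus e (s + S.joint a₁' b₁') q' else 0) =
      if restrictHom (Sum.elim x y) s = 0 then
        ∑ e, star (S.encode.kraus e (s + S.joint a₁ b₁) q) *
          S.encode.kraus e (s + S.joint a₁' b₁') q' else 0 := by
    intro s
    split_ifs <;> simp
  simp only [h1]
  rw [S.sum_ite_restrictHom_eq_zero]
  simp only [glue_zero_add _ _ _ hs, glue_zero_add _ _ _ hs']

end SharingScheme

end QRouting

end

/-! ### The theorem -/

theorem mainTheorem1 (n d : ℕ) (hd : 0 < d) (f : (Fin n ⊕ Fin n → Bool) → Bool)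
    (hf : QRouting.IsValidIndicator f)
    (S : QRouting.SharingScheme (Fin n ⊕ Fin n) d) (hS : S.HasIndicator f) :
    (∃ P : QRouting.RoutingProtocol n d, P.Completes f ∧ Fintype.card P.L = ∏ i, S.dim i) ∧
      QRouting.entanglementCost n d f ≤ ((S.size : ℝ) : EReal) := by
  classical
  have hdim := S.dim_ne_zero hd
  -- Nonzero dimensions make each `Fin (S.dim i)` a cyclic group, as teleportation requires.
  have : ∀ i, NeZero (S.dim i) := fun i => ⟨hdim i⟩
  obtain ⟨P, hP, hcard⟩ := QRouting.exists_completes_of_correctable S.isometry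
    (fun x => QRouting.restrictHom x) (fun y => QRouting.restrictHom y) hd S.isIsometry_isometry f
    (fun x => QRouting.restrictHom_restrictHom x) (fun y => QRouting.restrictHom_restrictHom y)
    (fun x y h => S.rightCorrectable ((hS (Sum.elim x y)).1 h))
    (fun x y h => S.leftCorrectable ((hS (Sum.elim x y)).2 h))
  have hL : Fintype.card P.L = ∏ i, S.dim i := by
    rw [hcard, Fintype.prod_sum_type]
    simp
  refine ⟨⟨P, hP, hL⟩, (iInf₂_le P hP).trans (EReal.coe_le_coe_iff.2 (le_of_eq ?_))⟩
  rw [QRouting.RoutingProtocol.entanglement, hL, QRouting.SharingScheme.size, Nat.cast_prod,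
    Real.logb_prod _ _ fun i _ => by exact_mod_cast hdim i]
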